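/- **Conventions.** For a finite-dimensional C*-algebra $B$ with a faithful positive functional $\psi$, put $\langle a,b\rangle_\psi=\psi(a^*b)$, and on $B\otimes B$ use $\psi\otimes\psi$; all adjoints are taken with respect to these inner products. The pair $(B,\psi)$ is a *quantum set* if the multiplication $m:B\otimes B\to B$ satisfies $mm^*=\mathrm{Id}_B$; for instance $(M_2,2\mathrm{Tr})$, and $(\mathbb C^V,\psi_V)$ with $\psi_V(f)=\sum_{v\in V}f(v)$ for a finite set $V$. A *quantum graph* on $(B,\psi)$ is a linear map $A:B\to B$ with $m(A\otimes A)m^*=A$ and $A(b^*)=A(b)^*$ for all $b$. It is *undirected* if $A=A^*$ and *loopfree* if $m(A\otimes\mathrm{Id})m^*=0$. A classical graph on $V$ is identified with its adjacency matrix, a quantum graph on $(\mathbb C^V,\psi_V)$. Quantum graphs $A_1$ on $(B_1,\psi_1)$ and $A_2$ on $(B_2,\psi_2)$ are *isomorphic* if there is a $*$-isomorphism $\varphi:B_1\to B_2$ with $\psi_2\varphi=\psi_1$ and $\varphi A_1=A_2\varphi$. They are *quantum isomorphic*, $A_1\cong_q A_2$, if there are a nonzero finite-dimensional Hilbert space $H$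 and a unital $*$-homomorphism $\rho:B_1\to B_2\otimes B(H)$ such that $a\otimes\xi\mapsto\rho(a)(1\otimes\xi)$ defines a unitary $L^2(B_1,\psi_1)\otimes H\to L^2(B_2,\psi_2)\otimes H$ and $\rho A_1=(A_2\otimes\mathrm{Id}_{B(H)})\rho$. Let $G$ be a finite abelian group with dual $\hat G$, let $n=|G|$, and let $\hat\alpha$ be an action of $\hat G$ on a quantum set $(\tilde B,\tilde\psi)$ by $\tilde\psi$-preserving $*$-automorphisms. The crossed product $\tilde B\rtimes_{\hat\alpha}\hat G$ consists of the sums $\sum_\chi b_\chi u_\chi$ with $b_\chi\in\tilde B$, where $(bu_\chi)(cu_\xi)=b\,\hat\alpha_\chi(c)u_{\chi\xi}$ and $(bu_\chi)^*=\hat\alpha_{\chi^{-1}}(b^*)u_{\chi^{-1}}$. It carries the functional $\psi_\rtimes(\sum_\chi b_\chi u_\chi)=n\tilde\psi(b_1)$ and the map $E(\sum_\chi b_\chi u_\chi)=n\,b_1$ to $\tilde B$. A *voltage quantum graph* with respect to $\hat\alpha$ is a family $\tilde A=(\tilde A_g)_{g\in G}$ of quantum graphs on $(\tilde B,\tilde\psi)$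 commuting with every $\hat\alpha_\chi$. Its *derived quantum graph* is $$\tilde A\rtimes_{\hat\alpha}\hat G=\sum_{g\in G}m\,(X_g\otimes E^*\tilde A_gE)\,m^*,\qquad X_g(b)=\frac1n\sum_{\chi\in\hat G}\overline{\chi(g)}\,\langle u_\chi,b\rangle_{\psi_\rtimes}\,u_\chi .$$ A classical $G$-voltage graph on $V$ is a finite directed graph on $V$ (loops and multiple edges allowed) whose edges are labelled by elements of $G$. It is *pre-simple* if for all $u,v\in V$ and $g\in G$ there is at most one edge $u\to v$ labelled $g$; then $\tilde A_g$ denotes the adjacency matrix of the subgraph of the edges labelled $g$. **Proposition.** Let $A$ be an undirected loopfree quantum graph on $(M_2,2\mathrm{Tr})$, and let $\hat\alpha$ be the action of $\hat{\mathbb Z}_2$ on $(\mathbb C^2,\psi_2)$ in which the nontrivial character swaps the two coordinates. 1. There is a pre-simple classical $\mathbb Z_2$-voltage graph on two vertices whose family $\tilde A=(\tilde A_0,\tilde A_1)$ is a voltage quantum graph on $(\mathbb C^2,\psi_2)$ with respect to $\hat\alpha$, such that $\tilde A\rtimes_{\hat\alpha}\hat{\mathbb Z}_2$ is a quantum graph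 on the quantum set $(\mathbb C^2\rtimes_{\hat\alpha}\hat{\mathbb Z}_2,\psi_\rtimes)$ and $A$ is isomorphic to it. 2. There is a simple graph $\Delta$ on four vertices (undirected, without loops), with adjacency matrix $A_\Delta$ on $(\mathbb C^4,\psi_4)$, such that $A\cong_q A_\Delta$ and $A_\Delta\cong_q A$. -/

import Mathlib

open scoped TensorProduct

noncomputable section

/-! ### Finite quantum sets and quantum graphs

A finite-dimensional C*-algebra with a faithful positive functional is given here as a
finite-dimensional unital complex star-algebra `B` with a linear functional `ψ` satisfying
`ψ (b* b) ≥ 0`, with equality only for `b = 0`.  No norm is recorded: such a star-algebra is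
faithfully represented on its GNS space, hence carries a (unique) C*-norm. -/

section QuantumSets

variable {B B₁ B₂ : Type*}
  [Ring B] [StarRing B] [Algebra ℂ B] [StarModule ℂ B]
  [Ring B₁] [StarRing B₁] [Algebra ℂ B₁] [StarModule ℂ B₁]
  [Ring B₂] [StarRing B₂] [Algebra ℂ B₂] [StarModule ℂ B₂]

/-- The GNS inner product `⟨x, y⟩_ψ = ψ (x* y)`. -/
def gnsInner (ψ : B →ₗ[ℂ] ℂ) (x y : B) : ℂ := ψ (star x * y)

/-- `S` is an adjoint of `T` for the inner products induced by `ψ₁` and `ψ₂`. -/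
def IsGNSAdjoint (ψ₁ : B₁ →ₗ[ℂ] ℂ) (ψ₂ : B₂ →ₗ[ℂ] ℂ) (T : B₁ →ₗ[ℂ] B₂) (S : B₂ →ₗ[ℂ] B₁) : Prop :=
  ∀ x y, gnsInner ψ₂ (T x) y = gnsInner ψ₁ x (S y)

open Classical in
/-- The adjoint `T*` of `T : L²(B₁, ψ₁) → L²(B₂, ψ₂)`.  (It exists and is unique when the algebras
are finite-dimensional and the functionals are faithful and positive; the value is `0` if there
is no adjoint.) -/
def gnsAdjoint (ψ₁ : B₁ →ₗ[ℂ] ℂ) (ψ₂ : B₂ →ₗ[ℂ] ℂ) (T : B₁ →ₗ[ℂ] B₂) : B₂ →ₗ[ℂ] B₁ :=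
  if h : ∃ S, IsGNSAdjoint ψ₁ ψ₂ T S then h.choose else 0

/-- The functional `ψ ⊗ ψ` on `B ⊗ B`. -/
def tensorFunctional (ψ : B →ₗ[ℂ] ℂ) : B ⊗[ℂ] B →ₗ[ℂ] ℂ :=
  LinearMap.mul' ℂ ℂ ∘ₗ TensorProduct.map ψ ψ

/-- The comultiplication `m* : B → B ⊗ B`, the adjoint of the multiplication map `m`. -/
def comulMap (ψ : B →ₗ[ℂ] ℂ) : B →ₗ[ℂ] B ⊗[ℂ] B :=
  gnsAdjoint (tensorFunctional ψ) ψ (LinearMap.mul' ℂ B)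

/-- `(B, ψ)` is a quantum set: `B` is finite-dimensional, `ψ` is a faithful positive functional,
and `m m* = Id`. -/
structure IsQuantumSet (ψ : B →ₗ[ℂ] ℂ) : Prop where
  finiteDimensional : FiniteDimensional ℂ B
  nonneg : ∀ b, 0 ≤ (ψ (star b * b)).re ∧ (ψ (star b * b)).im = 0
  faithful : ∀ b, ψ (star b * b) = 0 → b = 0
  mul_comul : LinearMap.mul' ℂ B ∘ₗ comulMap ψ = LinearMap.id

/-- The Schur product `m (S ⊗ T) m*` of two linear maps on `B`. -/
def schurMul (ψ : B →ₗ[ℂ] ℂ) (S T : B →ₗ[ℂ] B) : B →ₗ[ℂ] B :=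
  LinearMap.mul' ℂ B ∘ₗ TensorProduct.map S T ∘ₗ comulMap ψ

/-- `A` is a quantum adjacency matrix (a quantum graph) on `(B, ψ)`. -/
structure IsQuantumGraph (ψ : B →ₗ[ℂ] ℂ) (A : B →ₗ[ℂ] B) : Prop where
  schur_idempotent : schurMul ψ A A = A
  map_star : ∀ b, A (star b) = star (A b)

/-- Undirected quantum graphs: `A = A*`. -/
def IsUndirected (ψ : B →ₗ[ℂ] ℂ) (A : B →ₗ[ℂ] B) : Prop := A = gnsAdjoint ψ ψ A

/-- Loopfree quantum graphs: `m (A ⊗ Id) m* = 0`. -/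
def IsLoopfree (ψ : B →ₗ[ℂ] ℂ) (A : B →ₗ[ℂ] B) : Prop := schurMul ψ A LinearMap.id = 0

/-- Isomorphism of quantum graphs: a star-isomorphism of the algebras that preserves the
functionals and intertwines the quantum adjacency matrices. -/
def QuantumGraphIsomorphic (ψ₁ : B₁ →ₗ[ℂ] ℂ) (A₁ : B₁ →ₗ[ℂ] B₁)
    (ψ₂ : B₂ →ₗ[ℂ] ℂ) (A₂ : B₂ →ₗ[ℂ] B₂) : Prop :=
  ∃ φ : B₁ ≃⋆ₐ[ℂ] B₂, (∀ b, ψ₂ (φ b) = ψ₁ b) ∧ ∀ b, φ (A₁ b) = A₂ (φ b)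

/-! ### Quantum isomorphism

For the Hilbert space `H = ℂ^d` we write `B ⊗ B(H)` as the star-algebra of `d × d` matrices over
`B`, and `L²(B) ⊗ H` as the space of `d`-tuples of elements of `B`
(the tuple `x` stands for `∑ i, x i ⊗ e_i`). -/

/-- The inner product of `L²(B, ψ) ⊗ ℂ^d`. -/
def ampInner {d : ℕ} (ψ : B →ₗ[ℂ] ℂ) (x y : Fin d → B) : ℂ := ∑ i, gnsInner ψ (x i) (y i)

/-- The linear map `p : L²(B₁) ⊗ ℂ^d → L²(B₂) ⊗ ℂ^d`, `a ⊗ ξ ↦ ρ(a) (1 ⊗ ξ)`; on tuples,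
`∑ j, x j ⊗ e_j ↦ ∑ j, ρ(x j) (1 ⊗ e_j) = ∑ i, (∑ j, ρ(x j)_{i j}) ⊗ e_i`. -/
def ampMap {d : ℕ} (ρ : B₁ →⋆ₐ[ℂ] Matrix (Fin d) (Fin d) B₂) (x : Fin d → B₁) : Fin d → B₂ :=
  fun i => ∑ j, ρ (x j) i j

/-- `ρ : B₁ → B₂ ⊗ B(ℂ^d)` is a quantum isomorphism of quantum sets: it is a unital
star-homomorphism (by its type) and `p` is unitary. -/
structure IsQuantumIso {d : ℕ} (ψ₁ : B₁ →ₗ[ℂ] ℂ) (ψ₂ : B₂ →ₗ[ℂ] ℂ)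
    (ρ : B₁ →⋆ₐ[ℂ] Matrix (Fin d) (Fin d) B₂) : Prop where
  bijective : Function.Bijective (ampMap ρ)
  inner_map : ∀ x y, ampInner ψ₂ (ampMap ρ x) (ampMap ρ y) = ampInner ψ₁ x y

/-- Quantum isomorphism of quantum graphs: there are a nonzero finite-dimensional Hilbert space
`ℂ^d` and a quantum isomorphism `ρ` of the quantum sets with `ρ A₁ = (A₂ ⊗ Id) ρ`. -/
def QuantumGraphQuantumIsomorphic (ψ₁ : B₁ →ₗ[ℂ] ℂ) (A₁ : B₁ →ₗ[ℂ] B₁)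
    (ψ₂ : B₂ →ₗ[ℂ] ℂ) (A₂ : B₂ →ₗ[ℂ] B₂) : Prop :=
  ∃ (d : ℕ) (ρ : B₁ →⋆ₐ[ℂ] Matrix (Fin d) (Fin d) B₂),
    0 < d ∧ IsQuantumIso ψ₁ ψ₂ ρ ∧ ∀ b, ρ (A₁ b) = (ρ b).map A₂

end QuantumSets

/-! ### Crossed products by finite groups -/

/-- The underlying space of the crossed product `B ⋊_α Γ`: the function `x` stands for
`∑ χ, x χ u_χ`. -/
def CrossedProduct {B Γ : Type*} [Ring B] [StarRing B] [Algebra ℂ B] [Group Γ]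
    (_α : Γ →* (B ≃⋆ₐ[ℂ] B)) : Type _ := Γ → B

namespace CrossedProduct

variable {B Γ : Type*} [Ring B] [StarRing B] [Algebra ℂ B] [Group Γ] {α : Γ →* (B ≃⋆ₐ[ℂ] B)}

instance (priority := 10) instAddCommGroup : AddCommGroup (CrossedProduct α) := inferInstanceAs (AddCommGroup (Γ → B))

instance (priority := 10) instSMul : SMul ℂ (CrossedProduct α) := inferInstanceAs (SMul ℂ (Γ → B))

@[ext] theorem ext {x y : CrossedProduct α} (h : ∀ χ, x χ = y χ) : x = y := funext h

@[simp] theorem add_apply (x y : CrossedProduct α) (χ : Γ) : (x + y) χ = x χ + y χ := rfl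

@[simp] theorem zero_apply (χ : Γ) : (0 : CrossedProduct α) χ = 0 := rfl

@[simp] theorem smul_apply (c : ℂ) (x : CrossedProduct α) (χ : Γ) : (c • x) χ = c • x χ := rfl

open Classical in
/-- The element `b u_χ`. -/
def single (χ : Γ) (b : B) : CrossedProduct α := Pi.single χ b

/-- The canonical unitaries `u_χ`. -/
def u (χ : Γ) : CrossedProduct α := single χ 1

theorem map_mul_act (χ ξ : Γ) (b : B) : α (χ * ξ) b = α χ (α ξ b) := by
  rw [map_mul]; rfl

theorem map_one_act (b : B) : α 1 b = b := by
  rw [map_one]; rfl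

theorem act_inv_act (χ : Γ) (b : B) : α χ ((α χ)⁻¹ b) = b := by
  rw [← map_inv, ← map_mul_act, mul_inv_cancel, map_one_act]

/-- The involution `(b u_χ)* = α_{χ⁻¹}(b*) u_{χ⁻¹}`. -/
instance : Star (CrossedProduct α) := ⟨fun x η => α η (star (x η⁻¹))⟩

theorem star_apply (x : CrossedProduct α) (η : Γ) : star x η = α η (star (x η⁻¹)) := rfl

instance : One (CrossedProduct α) := ⟨u 1⟩

open Classical in
theorem one_apply (η : Γ) : (1 : CrossedProduct α) η = if η = 1 then 1 else 0 := by
  change (Pi.single (1 : Γ) (1 : B) : Γ → B) η = _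
  exact Pi.single_apply _ _ _

variable [Fintype Γ]

/-- The multiplication `(b u_χ) (c u_ξ) = b α_χ(c) u_{χ ξ}`. -/
instance : Mul (CrossedProduct α) := ⟨fun x y η => ∑ χ, x χ * α χ (y (χ⁻¹ * η))⟩

theorem mul_apply (x y : CrossedProduct α) (η : Γ) :
    (x * y) η = ∑ χ, x χ * α χ (y (χ⁻¹ * η)) := rfl

instance : Ring (CrossedProduct α) :=
  { (inferInstance : AddCommGroup (CrossedProduct α)),
    (inferInstance : Mul (CrossedProduct α)),
    (inferInstance : One (CrossedProduct α)) with
    left_distrib := fun x y z => by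
      ext η; simp [mul_apply, mul_add, Finset.sum_add_distrib]
    right_distrib := fun x y z => by
      ext η; simp [mul_apply, add_mul, Finset.sum_add_distrib]
    zero_mul := fun x => by ext η; simp [mul_apply]
    mul_zero := fun x => by ext η; simp [mul_apply]
    one_mul := fun x => by
      ext η
      rw [mul_apply, Finset.sum_eq_single 1]
      · simp [one_apply]
      · intro χ _ h; simp [one_apply, h]
      · simp
    mul_one := fun x => by
      ext η
      rw [mul_apply, Finset.sum_eq_single η]
      · simp [one_apply]
      · intro χ _ h
        have : χ⁻¹ * η ≠ 1 := fun h' => h (by rw [inv_mul_eq_one] at h'; exact h')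
        simp [one_apply, this]
      · simp
    mul_assoc := fun x y z => by
      ext η
      simp only [mul_apply, map_sum, map_mul, Finset.mul_sum, Finset.sum_mul]
      rw [Finset.sum_comm]
      refine Finset.sum_congr rfl fun χ _ => ?_
      rw [← Equiv.sum_comp (Equiv.mulLeft χ)]
      refine Finset.sum_congr rfl fun ξ _ => ?_
      simp only [Equiv.coe_mulLeft, inv_mul_cancel_left, map_mul_act, mul_inv_rev, mul_assoc] }

instance : StarRing (CrossedProduct α) where
  star_involutive x := by
    ext η
    simp [star_apply, ← map_star, act_inv_act]
  star_add x y := by ext η; simp [star_apply]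
  star_mul x y := by
    ext η
    simp only [star_apply, mul_apply, star_sum, star_mul, map_sum, map_mul]
    rw [← Equiv.sum_comp (Equiv.mulLeft η⁻¹)]
    refine Finset.sum_congr rfl fun ξ _ => ?_
    simp [← map_star, act_inv_act]

instance : Algebra ℂ (CrossedProduct α) where
  toSMul := instSMul
  algebraMap :=
    { toFun := fun c => c • 1
      map_one' := by ext η; simp
      map_mul' := fun c d => by
        ext η
        rw [mul_apply, Finset.sum_eq_single 1]
        · simp [one_apply, mul_smul, smul_comm c d]
        · intro χ _ h; simp [one_apply, h]
        · simp
      map_zero' := by ext η; simp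
      map_add' := fun c d => by ext η; simp [add_smul] }
  commutes' c x := by
    change (c • (1 : CrossedProduct α)) * x = x * (c • 1)
    have h1 : (c • (1 : CrossedProduct α)) * x = c • (1 * x) := by
      ext η; simp only [mul_apply, smul_apply, Finset.smul_sum, smul_mul_assoc]
    have h2 : x * (c • (1 : CrossedProduct α)) = c • (x * 1) := by
      ext η; simp only [mul_apply, smul_apply, Finset.smul_sum, map_smul, mul_smul_comm]
    rw [h1, h2, one_mul, mul_one]
  smul_def' c x := by
    change c • x = (c • (1 : CrossedProduct α)) * x
    have h1 : (c • (1 : CrossedProduct α)) * x = c • (1 * x) := by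
      ext η; simp only [mul_apply, smul_apply, Finset.smul_sum, smul_mul_assoc]
    rw [h1, one_mul]

instance [StarModule ℂ B] : StarModule ℂ (CrossedProduct α) where
  star_smul c x := by ext η; simp [star_apply]

/-- The functional `ψ_⋊ (∑ b_χ u_χ) = n ψ(b_1)`, where `n` is the order of the group. -/
def functional (α : Γ →* (B ≃⋆ₐ[ℂ] B)) (ψ : B →ₗ[ℂ] ℂ) : CrossedProduct α →ₗ[ℂ] ℂ where
  toFun x := (Fintype.card Γ : ℂ) * ψ (x 1)
  map_add' x y := by simp [mul_add]
  map_smul' c x := by simp [mul_left_comm]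

/-- The map `E_⋊ (∑ b_χ u_χ) = n b_1`, where `n` is the order of the group. -/
def condExp (α : Γ →* (B ≃⋆ₐ[ℂ] B)) : CrossedProduct α →ₗ[ℂ] B where
  toFun x := (Fintype.card Γ : ℂ) • x 1
  map_add' x y := by simp
  map_smul' c x := smul_comm _ _ _

end CrossedProduct

/-! ### Voltage quantum graphs and derived quantum graphs

The finite abelian group `G` is written additively, its dual multiplicatively. -/

section Derived

/-- The dual of a finite abelian group (its characters with values in `ℂ`). -/
abbrev DualGroup (G : Type*) [AddCommGroup G] : Type _ := AddChar G ℂ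

instance instFintypeDual {G : Type*} [AddCommGroup G] [Finite G] : Fintype (DualGroup G) :=
  AddChar.instFintype G ℂ

variable {B G : Type*} [Ring B] [StarRing B] [Algebra ℂ B] [StarModule ℂ B]
  [AddCommGroup G] [Fintype G]

/-- `A = (A_g)` is a voltage quantum graph on `(B, ψ)` with respect to the action `α` of the dual
group on `(B, ψ)`. -/
structure IsVoltageQuantumGraph (ψ : B →ₗ[ℂ] ℂ) (α : DualGroup G →* (B ≃⋆ₐ[ℂ] B))
    (A : G → B →ₗ[ℂ] B) : Prop where
  isQuantumSet : IsQuantumSet ψ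
  functional_act : ∀ χ b, ψ (α χ b) = ψ b
  isQuantumGraph : ∀ g, IsQuantumGraph ψ (A g)
  commute_act : ∀ g χ b, A g (α χ b) = α χ (A g b)

/-- The map `X_g = (1/n) ∑ χ, conj(χ(g)) u_χ u_χ^†` on the crossed product, where
`u_χ^† b = ⟨u_χ, b⟩`. -/
def xMap (ψ : B →ₗ[ℂ] ℂ) (α : DualGroup G →* (B ≃⋆ₐ[ℂ] B)) (g : G) :
    CrossedProduct α →ₗ[ℂ] CrossedProduct α where
  toFun b := (Fintype.card G : ℂ)⁻¹ • ∑ χ : DualGroup G,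
    (star (χ g) * gnsInner (CrossedProduct.functional α ψ) (CrossedProduct.u χ) b) •
      (CrossedProduct.u χ : CrossedProduct α)
  map_add' b c := by
    simp only [gnsInner, mul_add, map_add, add_smul, Finset.sum_add_distrib, smul_add]
  map_smul' c b := by
    simp only [gnsInner, mul_smul_comm, map_smul, smul_eq_mul, RingHom.id_apply, Finset.smul_sum,
      smul_smul]
    exact Finset.sum_congr rfl fun χ _ => by congr 1; ring

/-- The derived quantum graph `∑ g, m (X_g ⊗ E* A_g E) m*` on the crossed product quantum set. -/
def derivedQuantumGraph (ψ : B →ₗ[ℂ] ℂ) (α : DualGroup G →* (B ≃⋆ₐ[ℂ] B))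
    (A : G → B →ₗ[ℂ] B) : CrossedProduct α →ₗ[ℂ] CrossedProduct α :=
  ∑ g, schurMul (CrossedProduct.functional α ψ) (xMap ψ α g)
    (gnsAdjoint (CrossedProduct.functional α ψ) ψ (CrossedProduct.condExp α) ∘ₗ A g ∘ₗ
      CrossedProduct.condExp α)

end Derived

/-! ### Classical objects -/

/-- The functional `ψ_V(f) = ∑ v, f v` on `ℂ^V`. -/
def classicalFunctional (V : Type*) [Fintype V] : (V → ℂ) →ₗ[ℂ] ℂ :=
  ∑ v, LinearMap.proj v

open Classical in
/-- The adjacency matrix on `ℂ^V` of the directed graph on `V` with an edge `v → w` iff `r v w`;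
it maps `e_v` to `∑ w with r v w, e_w`. -/
def adjacencyMap {V : Type*} [Fintype V] (r : V → V → Prop) : (V → ℂ) →ₗ[ℂ] (V → ℂ) :=
  Matrix.toLin' (Matrix.of fun w v => if r v w then (1 : ℂ) else 0)

/-- A voltage graph on the vertex set `V`: a finite directed graph (loops and multiple edges
allowed) with edges labelled by elements of `G`. -/
structure VoltageGraph (V G : Type*) where
  /-- the edges -/
  E : Type
  finite_edges : Finite E
  /-- starting vertex -/
  s : E → V
  /-- terminal vertex -/
  t : E → V
  /-- the labelling -/
  label : E → G

namespace VoltageGraph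

variable {V G : Type*}

/-- For any vertices `u, v` and any label `g` there is at most one edge `u → v` labelled `g`. -/
def PreSimple (Γ : VoltageGraph V G) : Prop :=
  ∀ e f : Γ.E, Γ.s e = Γ.s f → Γ.t e = Γ.t f → Γ.label e = Γ.label f → e = f

/-- The adjacency matrix of the subgraph of all edges labelled by `g`. -/
def adjacency [Fintype V] (Γ : VoltageGraph V G) (g : G) : (V → ℂ) →ₗ[ℂ] (V → ℂ) :=
  adjacencyMap fun v w => ∃ e : Γ.E, Γ.s e = v ∧ Γ.t e = w ∧ Γ.label e = g

end VoltageGraph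

/-- The action of a group on `ℂ^V` induced by an action on the set `V`: `e_v ↦ e_{σ_χ(v)}`. -/
def permAction {V Γ : Type*} [Group Γ] (σ : Γ →* Equiv.Perm V) :
    Γ →* ((V → ℂ) ≃⋆ₐ[ℂ] (V → ℂ)) where
  toFun χ :=
    { toFun := fun f v => f ((σ χ)⁻¹ v)
      invFun := fun f v => f (σ χ v)
      left_inv := fun f => by ext v; simp
      right_inv := fun f => by ext v; simp
      map_mul' := fun f g => rfl
      map_add' := fun f g => rfl
      map_star' := fun f => rfl
      map_smul' := fun c f => rfl }
  map_one' := by ext f v; simp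
  map_mul' χ ξ := by ext f v; simp

/-- The action of the dual of `ℤ/2` on two points in which the nontrivial character swaps them. -/
def swapHom : DualGroup (ZMod 2) →* Equiv.Perm (Fin 2) where
  toFun χ := if χ = 1 then 1 else Equiv.swap 0 1
  map_one' := by simp
  map_mul' χ ξ := by
    have key : ∀ η : DualGroup (ZMod 2), η ≠ 1 → η 1 = -1 := by
      intro η hη
      have h2 : η 1 * η 1 = 1 := by
        rw [← AddChar.map_add_eq_mul, show (1 + 1 : ZMod 2) = 0 by decide,
          AddChar.map_zero_eq_one]
      rcases mul_self_eq_one_iff.mp h2 with h | h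
      · refine absurd (DFunLike.ext _ _ fun a => ?_) hη
        fin_cases a
        · exact η.map_zero_eq_one
        · exact h
      · exact h
    by_cases h1 : χ = 1
    · simp [h1]
    by_cases h2 : ξ = 1
    · simp [h2]
    have h3 : χ * ξ = 1 := by
      refine DFunLike.ext _ _ fun a => ?_
      fin_cases a
      · exact (χ * ξ).map_zero_eq_one
      · change χ 1 * ξ 1 = 1
        rw [key χ h1, key ξ h2]; norm_num
    simp [h1, h2, h3]

/-- The action of the dual of `ℤ/2` on `ℂ²` that swaps the coordinates. -/
def swapAction : DualGroup (ZMod 2) →* ((Fin 2 → ℂ) ≃⋆ₐ[ℂ] (Fin 2 → ℂ)) := permAction swapHom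

/-- The functional `2 Tr` on the algebra of complex `2 × 2` matrices. -/
def twoTrace : Matrix (Fin 2) (Fin 2) ℂ →ₗ[ℂ] ℂ := (2 : ℂ) • Matrix.traceLinearMap (Fin 2) ℂ ℂ

end

/-! The Choi matrix `P` of `A`, scaled by one half, turns the Schur product on `M₂` into the matrix
product. A quantum graph thus gives a hermitian projection on `ℂ² ⊗ ℂ²`. Loopfreeness says that `P`
kills the vectorised identity, so `P` lives on the span of the vectorised Pauli matrices.
Undirectedness says that `P` is real in the Pauli basis, so `A` is encoded by a real symmetric
projection `Q` of size three (`exists_real_projection`). Such a `Q` is `0`, `v vᵀ`, `1 - v vᵀ` or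
`1` for a unit vector `v`. The matrix `H = ∑ v_a σ_a` is a traceless hermitian unitary, and `A` is a
sum of some of `x ↦ H x H` and `x ↦ 2 Tr(x) 1 - x - H x H` (`exists_hermitian_unitary`). A unitary
conjugation carries `H` to `±σ_z`, so up to isomorphism only the four graphs `pauliGraph p q` remain
(`exists_isomorphic_pauliGraph`). For these four both claims are explicit. Identifying `ℂ² ⋊ ℤ/2`
with `M₂`, with `σ_x` as the nontrivial canonical unitary, makes `pauliGraph p q` the derived graph
of a two-vertex voltage graph (`derivedQuantumGraph_qubitEquivCrossedProduct`). Modulo phases the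
Pauli matrices form the Klein four-group, and `pauliGraph p q` is quantum isomorphic to a Cayley
graph of that group: the empty graph, two disjoint edges, the four-cycle or the complete graph. -/

noncomputable section

/-! ### Adjoints computed from an orthogonal basis -/

section General

variable {B B₁ B₂ B₃ : Type*}
  [Ring B] [StarRing B] [Algebra ℂ B] [StarModule ℂ B]
  [Ring B₁] [StarRing B₁] [Algebra ℂ B₁] [StarModule ℂ B₁]
  [Ring B₂] [StarRing B₂] [Algebra ℂ B₂] [StarModule ℂ B₂]
  [Ring B₃] [StarRing B₃] [Algebra ℂ B₃] [StarModule ℂ B₃]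

omit [StarModule ℂ B] in
theorem gnsInner_add_left (ψ : B →ₗ[ℂ] ℂ) (x y z : B) :
    gnsInner ψ (x + y) z = gnsInner ψ x z + gnsInner ψ y z := by
  simp [gnsInner, add_mul]

omit [StarModule ℂ B] in
theorem gnsInner_add_right (ψ : B →ₗ[ℂ] ℂ) (x y z : B) :
    gnsInner ψ x (y + z) = gnsInner ψ x y + gnsInner ψ x z := by
  simp [gnsInner, mul_add]

theorem gnsInner_smul_left (ψ : B →ₗ[ℂ] ℂ) (c : ℂ) (x y : B) :
    gnsInner ψ (c • x) y = star c * gnsInner ψ x y := by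
  simp [gnsInner]

omit [StarModule ℂ B] in
theorem gnsInner_smul_right (ψ : B →ₗ[ℂ] ℂ) (c : ℂ) (x y : B) :
    gnsInner ψ x (c • y) = c * gnsInner ψ x y := by
  simp [gnsInner]

omit [StarModule ℂ B] in
theorem gnsInner_sum_left {ι : Type*} (ψ : B →ₗ[ℂ] ℂ) (s : Finset ι) (x : ι → B) (y : B) :
    gnsInner ψ (∑ i ∈ s, x i) y = ∑ i ∈ s, gnsInner ψ (x i) y := by
  simp [gnsInner, Finset.sum_mul]

omit [StarModule ℂ B] in
theorem gnsInner_sum_right {ι : Type*} (ψ : B →ₗ[ℂ] ℂ) (s : Finset ι) (x : B) (y : ι → B) :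
    gnsInner ψ x (∑ i ∈ s, y i) = ∑ i ∈ s, gnsInner ψ x (y i) := by
  simp [gnsInner, Finset.mul_sum]

theorem gnsInner_tmul (ψ : B →ₗ[ℂ] ℂ) (x y z w : B) :
    gnsInner (tensorFunctional ψ) (x ⊗ₜ[ℂ] y) (z ⊗ₜ[ℂ] w) = gnsInner ψ x z * gnsInner ψ y w := by
  simp [gnsInner, tensorFunctional]

open Classical in
/-- The basis `b` is orthogonal for the inner product of `ψ`, all its vectors having the same
nonzero square norm `r`. -/
structure IsGNSOrthogonal {ι : Type*} (ψ : B →ₗ[ℂ] ℂ) (b : Module.Basis ι ℂ B) (r : ℂ) : Prop where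
  ne_zero : r ≠ 0
  inner : ∀ i j, gnsInner ψ (b i) (b j) = if i = j then r else 0

namespace IsGNSOrthogonal

variable {ι : Type*} [Fintype ι] {ψ : B →ₗ[ℂ] ℂ} {b : Module.Basis ι ℂ B} {r : ℂ}

omit [StarModule ℂ B] in
theorem inner_basis (h : IsGNSOrthogonal ψ b r) (i : ι) (x : B) :
    gnsInner ψ (b i) x = r * b.repr x i := by
  classical
  conv_lhs => rw [← b.sum_repr x]
  rw [gnsInner_sum_right, Finset.sum_eq_single i]
  · rw [gnsInner_smul_right, h.inner, if_pos rfl, mul_comm]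
  · intro j _ hj
    rw [gnsInner_smul_right, h.inner, if_neg (Ne.symm hj), mul_zero]
  · simp

omit [StarModule ℂ B] in
theorem eq_zero (h : IsGNSOrthogonal ψ b r) {y : B} (hy : ∀ x, gnsInner ψ x y = 0) : y = 0 := by
  refine b.ext_elem fun i => ?_
  have := h.inner_basis i y
  rw [hy] at this
  simpa [h.ne_zero] using this.symm

omit [Fintype ι] in
theorem tensor (h : IsGNSOrthogonal ψ b r) :
    IsGNSOrthogonal (tensorFunctional ψ) (b.tensorProduct b) (r * r) where
  ne_zero := mul_ne_zero h.ne_zero h.ne_zero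
  inner := by
    rintro ⟨i, j⟩ ⟨k, l⟩
    rw [Module.Basis.tensorProduct_apply, Module.Basis.tensorProduct_apply, gnsInner_tmul,
      h.inner, h.inner]
    by_cases h1 : i = k <;> by_cases h2 : j = l <;> simp [h1, h2]

/-- An orthogonal basis of the source is enough for the formula `S y = ∑ i, r⁻¹ ⟨T b_i, y⟩ b_i`;
positivity plays no role. This keeps `gnsAdjoint` away from its default value `0`. -/
theorem exists_adjoint {ψ₁ : B₁ →ₗ[ℂ] ℂ} {b : Module.Basis ι ℂ B₁}
    (h : IsGNSOrthogonal ψ₁ b r) (ψ₂ : B₂ →ₗ[ℂ] ℂ) (T : B₁ →ₗ[ℂ] B₂) :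
    ∃ S, IsGNSAdjoint ψ₁ ψ₂ T S := by
  classical
  let S : B₂ →ₗ[ℂ] B₁ :=
    { toFun := fun y => ∑ i, (r⁻¹ * gnsInner ψ₂ (T (b i)) y) • b i
      map_add' := fun y z => by
        simp only [gnsInner_add_right, mul_add, add_smul, Finset.sum_add_distrib]
      map_smul' := fun c y => by
        simp only [gnsInner_smul_right, RingHom.id_apply, Finset.smul_sum, smul_smul]
        exact Finset.sum_congr rfl fun i _ => by congr 1; ring }
  refine ⟨S, fun x y => ?_⟩
  have key : ∀ i, gnsInner ψ₂ (T (b i)) y = gnsInner ψ₁ (b i) (S y) := by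
    intro i
    change _ = gnsInner ψ₁ (b i) (∑ j, (r⁻¹ * gnsInner ψ₂ (T (b j)) y) • b j)
    rw [gnsInner_sum_right, Finset.sum_eq_single i]
    · rw [gnsInner_smul_right, h.inner, if_pos rfl]
      field_simp [h.ne_zero]
    · intro j _ hj
      rw [gnsInner_smul_right, h.inner, if_neg (Ne.symm hj), mul_zero]
    · simp
  rw [← b.sum_repr x]
  simp only [map_sum, map_smul, gnsInner_sum_left, gnsInner_smul_left, key]

theorem isGNSAdjoint_gnsAdjoint {ψ₁ : B₁ →ₗ[ℂ] ℂ} {b : Module.Basis ι ℂ B₁}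
    (h : IsGNSOrthogonal ψ₁ b r) (ψ₂ : B₂ →ₗ[ℂ] ℂ) (T : B₁ →ₗ[ℂ] B₂) :
    IsGNSAdjoint ψ₁ ψ₂ T (gnsAdjoint ψ₁ ψ₂ T) := by
  have h := h.exists_adjoint ψ₂ T
  rw [gnsAdjoint, dif_pos h]
  exact h.choose_spec

theorem gnsAdjoint_eq {ψ₁ : B₁ →ₗ[ℂ] ℂ} {b : Module.Basis ι ℂ B₁}
    (h : IsGNSOrthogonal ψ₁ b r) {ψ₂ : B₂ →ₗ[ℂ] ℂ} {T : B₁ →ₗ[ℂ] B₂} {S : B₂ →ₗ[ℂ] B₁}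
    (hS : IsGNSAdjoint ψ₁ ψ₂ T S) : gnsAdjoint ψ₁ ψ₂ T = S := by
  have h' := h.isGNSAdjoint_gnsAdjoint ψ₂ T
  refine LinearMap.ext fun y => sub_eq_zero.mp (h.eq_zero fun x => ?_)
  have := (h' x y).symm.trans (hS x y)
  rw [gnsInner, mul_sub, map_sub]
  exact sub_eq_zero.mpr this

/-- To identify the comultiplication it suffices to test on elementary tensors. -/
theorem comulMap_eq (h : IsGNSOrthogonal ψ b r) {δ : B →ₗ[ℂ] B ⊗[ℂ] B}
    (hδ : ∀ x y z, gnsInner ψ (x * y) z = gnsInner (tensorFunctional ψ) (x ⊗ₜ[ℂ] y) (δ z)) :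
    comulMap ψ = δ := by
  refine h.tensor.gnsAdjoint_eq fun x z => ?_
  induction x using TensorProduct.induction_on with
  | zero => simp [gnsInner]
  | tmul x y => exact hδ x y z
  | add x y hx hy => rw [map_add, gnsInner_add_left, gnsInner_add_left, hx, hy]

theorem comulMap_spec (h : IsGNSOrthogonal ψ b r) (x y z : B) :
    gnsInner ψ (x * y) z = gnsInner (tensorFunctional ψ) (x ⊗ₜ[ℂ] y) (comulMap ψ z) :=
  h.tensor.isGNSAdjoint_gnsAdjoint ψ (LinearMap.mul' ℂ B) (x ⊗ₜ[ℂ] y) z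

end IsGNSOrthogonal

/-! ### Transport along functional-preserving star-isomorphisms -/

section Transport

variable {ψ₁ : B₁ →ₗ[ℂ] ℂ} {ψ₂ : B₂ →ₗ[ℂ] ℂ} {φ : B₁ ≃⋆ₐ[ℂ] B₂}

/-- The linear equivalence underlying a star-isomorphism. -/
def StarAlgEquiv.toLin (φ : B₁ ≃⋆ₐ[ℂ] B₂) : B₁ ≃ₗ[ℂ] B₂ := φ.toAlgEquiv.toLinearEquiv

omit [StarModule ℂ B₁] [StarModule ℂ B₂] in
@[simp] theorem StarAlgEquiv.toLin_apply (φ : B₁ ≃⋆ₐ[ℂ] B₂) (x : B₁) : φ.toLin x = φ x := rfl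

omit [StarModule ℂ B₁] [StarModule ℂ B₂] in
@[simp] theorem StarAlgEquiv.toLin_symm_apply (φ : B₁ ≃⋆ₐ[ℂ] B₂) (x : B₂) :
    φ.toLin.symm x = φ.symm x := rfl

omit [StarModule ℂ B₁] [StarModule ℂ B₂] in
theorem gnsInner_map (hφ : ∀ b, ψ₂ (φ b) = ψ₁ b) (x y : B₁) :
    gnsInner ψ₂ (φ x) (φ y) = gnsInner ψ₁ x y := by
  rw [gnsInner, gnsInner, ← map_star, ← map_mul, hφ]

omit [StarModule ℂ B₁] [StarModule ℂ B₂] in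
theorem IsGNSOrthogonal.map {ι : Type*} {b : Module.Basis ι ℂ B₁} {r : ℂ}
    (h : IsGNSOrthogonal ψ₁ b r) (hφ : ∀ b, ψ₂ (φ b) = ψ₁ b) :
    IsGNSOrthogonal ψ₂ (b.map φ.toLin) r where
  ne_zero := h.ne_zero
  inner i j := by simp [gnsInner_map hφ, h.inner]

variable {ι : Type*} [Fintype ι] {b : Module.Basis ι ℂ B₁} {r : ℂ}

/-- Since `φ` is multiplicative and isometric, `(φ ⊗ φ) m* φ⁻¹` satisfies the adjunction equation
for the multiplication of `B₂`, and adjoints are unique. -/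
theorem comulMap_map (h : IsGNSOrthogonal ψ₁ b r) (hφ : ∀ b, ψ₂ (φ b) = ψ₁ b) (x : B₁) :
    comulMap ψ₂ (φ x) =
      TensorProduct.map φ.toLin.toLinearMap φ.toLin.toLinearMap (comulMap ψ₁ x) := by
  have key : ∀ (x y : B₁) (t : B₁ ⊗[ℂ] B₁),
      gnsInner (tensorFunctional ψ₂) (φ x ⊗ₜ[ℂ] φ y)
        (TensorProduct.map φ.toLin.toLinearMap φ.toLin.toLinearMap t) =
      gnsInner (tensorFunctional ψ₁) (x ⊗ₜ[ℂ] y) t := by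
    intro x y t
    induction t using TensorProduct.induction_on with
    | zero => simp [gnsInner]
    | tmul z w => simp [gnsInner_tmul, gnsInner_map hφ]
    | add s t hs ht => rw [map_add, gnsInner_add_right, gnsInner_add_right, hs, ht]
  have h2 := (h.map hφ).comulMap_eq
    (δ := TensorProduct.map φ.toLin.toLinearMap φ.toLin.toLinearMap ∘ₗ comulMap ψ₁ ∘ₗ
      φ.toLin.symm.toLinearMap) (fun u v w => by
      obtain ⟨u, rfl⟩ := EquivLike.surjective φ u
      obtain ⟨v, rfl⟩ := EquivLike.surjective φ v
      obtain ⟨w, rfl⟩ := EquivLike.surjective φ w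
      rw [← map_mul, gnsInner_map hφ, h.comulMap_spec, ← key]
      simp)
  rw [h2]
  simp

theorem schurMul_map (h : IsGNSOrthogonal ψ₁ b r) (hφ : ∀ b, ψ₂ (φ b) = ψ₁ b)
    {S₁ T₁ : B₁ →ₗ[ℂ] B₁} {S₂ T₂ : B₂ →ₗ[ℂ] B₂} (hS : ∀ b, φ (S₁ b) = S₂ (φ b))
    (hT : ∀ b, φ (T₁ b) = T₂ (φ b)) (x : B₁) :
    schurMul ψ₂ S₂ T₂ (φ x) = φ (schurMul ψ₁ S₁ T₁ x) := by
  simp only [schurMul, LinearMap.comp_apply]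
  rw [comulMap_map h hφ]
  induction comulMap ψ₁ x using TensorProduct.induction_on with
  | zero => simp
  | tmul z w => simp [hS, hT]
  | add s t hs ht => simp only [map_add, hs, ht]

theorem IsQuantumGraph.map (h : IsGNSOrthogonal ψ₁ b r) (hφ : ∀ b, ψ₂ (φ b) = ψ₁ b)
    {A₁ : B₁ →ₗ[ℂ] B₁} {A₂ : B₂ →ₗ[ℂ] B₂} (hA : ∀ b, φ (A₁ b) = A₂ (φ b))
    (hA₁ : IsQuantumGraph ψ₁ A₁) : IsQuantumGraph ψ₂ A₂ where
  schur_idempotent := by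
    refine LinearMap.ext fun y => ?_
    obtain ⟨y, rfl⟩ := EquivLike.surjective φ y
    rw [schurMul_map h hφ hA hA, hA₁.schur_idempotent, hA]
  map_star y := by
    obtain ⟨y, rfl⟩ := EquivLike.surjective φ y
    rw [← StarHomClass.map_star, ← hA, hA₁.map_star, StarHomClass.map_star, hA]

theorem IsQuantumSet.map (h : IsGNSOrthogonal ψ₁ b r) (hφ : ∀ b, ψ₂ (φ b) = ψ₁ b)
    (h₁ : IsQuantumSet ψ₁) : IsQuantumSet ψ₂ where
  finiteDimensional := Module.Basis.finiteDimensional_of_finite (b.map φ.toLin)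
  nonneg y := by
    obtain ⟨y, rfl⟩ := EquivLike.surjective φ y
    rw [← map_star, ← map_mul, hφ]
    exact h₁.nonneg y
  faithful y := by
    obtain ⟨y, rfl⟩ := EquivLike.surjective φ y
    rw [← map_star, ← map_mul, hφ]
    intro hy
    rw [h₁.faithful y hy, map_zero]
  mul_comul := by
    -- Writing `m m*` as the Schur product of two identities brings it under `schurMul_map`.
    have h1 : ∀ ψ : B₂ →ₗ[ℂ] ℂ, LinearMap.mul' ℂ B₂ ∘ₗ comulMap ψ =
        schurMul ψ LinearMap.id LinearMap.id := by
      intro ψ; rw [schurMul, TensorProduct.map_id, LinearMap.id_comp]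
    have h2 : LinearMap.mul' ℂ B₁ ∘ₗ comulMap ψ₁ = schurMul ψ₁ LinearMap.id LinearMap.id := by
      rw [schurMul, TensorProduct.map_id, LinearMap.id_comp]
    rw [h1]
    refine LinearMap.ext fun y => ?_
    obtain ⟨y, rfl⟩ := EquivLike.surjective φ y
    rw [schurMul_map h hφ (S₁ := LinearMap.id) (T₁ := LinearMap.id) (fun _ => rfl) (fun _ => rfl),
      ← h2, h₁.mul_comul]
    rfl

end Transport

/-! ### Composing isomorphisms with quantum isomorphisms -/

section Composition

variable {ψ₁ : B₁ →ₗ[ℂ] ℂ} {ψ₂ : B₂ →ₗ[ℂ] ℂ} {ψ₃ : B₃ →ₗ[ℂ] ℂ}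
  {A₁ : B₁ →ₗ[ℂ] B₁} {A₂ : B₂ →ₗ[ℂ] B₂} {A₃ : B₃ →ₗ[ℂ] B₃}

omit [StarModule ℂ B₁] [StarModule ℂ B₂] [StarModule ℂ B₃] in
theorem QuantumGraphIsomorphic.trans (h : QuantumGraphIsomorphic ψ₁ A₁ ψ₂ A₂)
    (h' : QuantumGraphIsomorphic ψ₂ A₂ ψ₃ A₃) : QuantumGraphIsomorphic ψ₁ A₁ ψ₃ A₃ := by
  obtain ⟨φ, h1, h2⟩ := h
  obtain ⟨θ, h3, h4⟩ := h'
  exact ⟨φ.trans θ, fun b => by simp [h1, h3], fun b => by simp [h2, h4]⟩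

omit [StarModule ℂ B₁] [StarModule ℂ B₂] [StarModule ℂ B₃] in
theorem QuantumGraphIsomorphic.trans_quantum (h : QuantumGraphIsomorphic ψ₁ A₁ ψ₂ A₂)
    (h' : QuantumGraphQuantumIsomorphic ψ₂ A₂ ψ₃ A₃) :
    QuantumGraphQuantumIsomorphic ψ₁ A₁ ψ₃ A₃ := by
  obtain ⟨φ, h1, h2⟩ := h
  obtain ⟨d, ρ, hd, hρ, h3⟩ := h'
  have key : ampMap (ρ.comp (φ : B₁ →⋆ₐ[ℂ] B₂)) = ampMap ρ ∘ fun x i => φ (x i) := rfl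
  refine ⟨d, ρ.comp (φ : B₁ →⋆ₐ[ℂ] B₂), hd, ⟨?_, fun x y => ?_⟩, fun b => ?_⟩
  · rw [key]
    exact hρ.bijective.comp (Equiv.piCongrRight fun _ => φ.toEquiv).bijective
  · rw [key, Function.comp_apply, Function.comp_apply, hρ.inner_map]
    exact Finset.sum_congr rfl fun i _ => gnsInner_map h1 _ _
  · change ρ (φ (A₁ b)) = (ρ (φ b)).map A₃
    rw [h2, h3]

/-- Apply a star-isomorphism to all entries of a matrix. -/
def StarAlgEquiv.mapMatrixHom (d : ℕ) (φ : B₁ ≃⋆ₐ[ℂ] B₂) :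
    Matrix (Fin d) (Fin d) B₁ →⋆ₐ[ℂ] Matrix (Fin d) (Fin d) B₂ :=
  { φ.toAlgEquiv.toAlgHom.mapMatrix with
    map_star' := fun M => by
      ext i j
      exact map_star φ (M j i) }

-- Symmetry of quantum isomorphism is not established, so the two directions of the final claim are
-- treated separately. This one composes with `φ⁻¹` on the target, entry by entry.
omit [StarModule ℂ B₁] [StarModule ℂ B₂] [StarModule ℂ B₃] in
theorem QuantumGraphQuantumIsomorphic.trans_symm (h : QuantumGraphQuantumIsomorphic ψ₁ A₁ ψ₃ A₃)
    (h' : QuantumGraphIsomorphic ψ₂ A₂ ψ₃ A₃) : QuantumGraphQuantumIsomorphic ψ₁ A₁ ψ₂ A₂ := by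
  obtain ⟨d, ρ, hd, hρ, h3⟩ := h
  obtain ⟨φ, h1, h2⟩ := h'
  have h1' : ∀ b, ψ₂ (φ.symm b) = ψ₃ b := fun b => by rw [← h1, φ.apply_symm_apply]
  have key : ampMap ((φ.symm.mapMatrixHom d).comp ρ) = (fun x i => φ.symm (x i)) ∘ ampMap ρ := by
    ext x i
    change ∑ j, φ.symm (ρ (x j) i j) = φ.symm (∑ j, ρ (x j) i j)
    rw [map_sum]
  refine ⟨d, (φ.symm.mapMatrixHom d).comp ρ, hd, ⟨?_, fun x y => ?_⟩, fun b => ?_⟩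
  · rw [key]
    exact (Equiv.piCongrRight fun _ => φ.symm.toEquiv).bijective.comp hρ.bijective
  · rw [key, ← hρ.inner_map]
    exact Finset.sum_congr rfl fun i _ => gnsInner_map h1' _ _
  · ext i j
    change φ.symm (ρ (A₁ b) i j) = A₂ (φ.symm (ρ b i j))
    rw [h3, Matrix.map_apply]
    apply EquivLike.injective φ
    rw [h2, φ.apply_symm_apply, φ.apply_symm_apply]

omit [StarModule ℂ B₁] [StarModule ℂ B₂] in
/-- An isometry between spaces of the same finite dimension is a quantum isomorphism. -/
theorem IsQuantumIso.of_inner_map {ι : Type*} [Fintype ι] {b : Module.Basis ι ℂ B₁} {r : ℂ}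
    (h : IsGNSOrthogonal ψ₁ b r) [FiniteDimensional ℂ B₁] [FiniteDimensional ℂ B₂]
    (hdim : Module.finrank ℂ B₁ = Module.finrank ℂ B₂) {d : ℕ}
    (ρ : B₁ →⋆ₐ[ℂ] Matrix (Fin d) (Fin d) B₂)
    (hρ : ∀ x y, ampInner ψ₂ (ampMap ρ x) (ampMap ρ y) = ampInner ψ₁ x y) :
    IsQuantumIso ψ₁ ψ₂ ρ where
  inner_map := hρ
  bijective := by
    let p : (Fin d → B₁) →ₗ[ℂ] (Fin d → B₂) :=
      { toFun := ampMap ρ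
        map_add' := fun x y => by ext i; simp [ampMap, Finset.sum_add_distrib]
        map_smul' := fun c x => by ext i; simp [ampMap, Finset.smul_sum] }
    have hinj : Function.Injective p := by
      rw [← LinearMap.ker_eq_bot, LinearMap.ker_eq_bot']
      intro x hx
      ext i
      refine h.eq_zero fun a => ?_
      -- Pairing with the tuple that has `a` in place `i` isolates `x i`, which nondegeneracy of the
      -- form then kills.
      have h0 := hρ (Pi.single i a) x
      have hx' : ampMap ρ x = 0 := hx
      have h1 : ampInner ψ₁ (Pi.single i a) x = gnsInner ψ₁ a (x i) := by
        rw [ampInner, Finset.sum_eq_single_of_mem i (Finset.mem_univ _), Pi.single_eq_same]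
        intro j _ hj
        simp [gnsInner, hj]
      rw [← h1, ← h0, hx']
      simp [ampInner, gnsInner]
    have hfin : Module.finrank ℂ (Fin d → B₁) = Module.finrank ℂ (Fin d → B₂) := by
      simp [Module.finrank_pi_fintype, hdim]
    exact ⟨hinj, (LinearMap.injective_iff_surjective_of_finrank_eq_finrank hfin).mp hinj⟩

end Composition

end General

/-! ### The quantum set of `2 × 2` matrices -/

section QubitGraphs

open Matrix

theorem twoTrace_apply (x : Matrix (Fin 2) (Fin 2) ℂ) : twoTrace x = 2 * (x 0 0 + x 1 1) := by
  simp [twoTrace, Matrix.trace_fin_two]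

theorem gnsInner_twoTrace (x y : Matrix (Fin 2) (Fin 2) ℂ) :
    gnsInner twoTrace x y = 2 * ∑ i, ∑ j, star (x i j) * y i j := by
  simp only [gnsInner, twoTrace_apply, Matrix.star_apply, Matrix.mul_apply, Fin.sum_univ_two]
  ring

theorem gnsInner_twoTrace_self (x : Matrix (Fin 2) (Fin 2) ℂ) :
    gnsInner twoTrace x x = ((2 * ∑ i, ∑ j, Complex.normSq (x i j) : ℝ) : ℂ) := by
  rw [gnsInner_twoTrace]
  push_cast
  simp only [RCLike.star_def, Complex.normSq_eq_conj_mul_self]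

theorem isGNSOrthogonal_twoTrace :
    IsGNSOrthogonal twoTrace (Matrix.stdBasis ℂ (Fin 2) (Fin 2)) 2 where
  ne_zero := two_ne_zero
  inner := by
    rintro ⟨i, j⟩ ⟨k, l⟩
    rw [gnsInner_twoTrace, Matrix.stdBasis_eq_single, Matrix.stdBasis_eq_single]
    fin_cases i <;> fin_cases j <;> fin_cases k <;> fin_cases l <;>
      simp [Fin.sum_univ_two, Matrix.single_apply]

/-- Matrix units have square norm `2` and their tensors square norm `4`, so `m*` sends `e_ij` to
`(2/4) ∑ k, e_ik ⊗ e_kj`. -/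
theorem comulMap_twoTrace (x : Matrix (Fin 2) (Fin 2) ℂ) :
    comulMap twoTrace x = (1 / 2 : ℂ) • ∑ i, ∑ j, ∑ k,
      x i j • (Matrix.single i k (1 : ℂ) ⊗ₜ[ℂ] Matrix.single k j (1 : ℂ)) := by
  let δ : Matrix (Fin 2) (Fin 2) ℂ →ₗ[ℂ]
      Matrix (Fin 2) (Fin 2) ℂ ⊗[ℂ] Matrix (Fin 2) (Fin 2) ℂ :=
    { toFun := fun x => (1 / 2 : ℂ) • ∑ i, ∑ j, ∑ k,
        x i j • (Matrix.single i k (1 : ℂ) ⊗ₜ[ℂ] Matrix.single k j (1 : ℂ))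
      map_add' := fun x y => by
        simp only [Matrix.add_apply, add_smul, Finset.sum_add_distrib, smul_add]
      map_smul' := fun c x => by
        simp only [Matrix.smul_apply, smul_eq_mul, mul_smul, RingHom.id_apply, Finset.smul_sum]
        simp only [smul_comm c] }
  have h : comulMap twoTrace = δ := by
    refine isGNSOrthogonal_twoTrace.comulMap_eq fun x y z => ?_
    change _ = gnsInner _ _ ((1 / 2 : ℂ) • ∑ i, ∑ j, ∑ k,
        z i j • ((Matrix.single i k 1 : Matrix (Fin 2) (Fin 2) ℂ) ⊗ₜ[ℂ]
          (Matrix.single k j 1 : Matrix (Fin 2) (Fin 2) ℂ)))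
    simp only [gnsInner_smul_right, gnsInner_sum_right, gnsInner_tmul]
    simp [gnsInner_twoTrace, Fin.sum_univ_two, Matrix.single_apply, Matrix.mul_apply]
    ring
  rw [h]
  rfl

theorem schurMul_twoTrace_apply (S T : Matrix (Fin 2) (Fin 2) ℂ →ₗ[ℂ] Matrix (Fin 2) (Fin 2) ℂ)
    (x : Matrix (Fin 2) (Fin 2) ℂ) :
    schurMul twoTrace S T x = (1 / 2 : ℂ) • ∑ i, ∑ j, ∑ k,
      x i j • (S (Matrix.single i k 1) * T (Matrix.single k j 1)) := by
  simp [schurMul, comulMap_twoTrace]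

theorem isQuantumSet_twoTrace : IsQuantumSet twoTrace where
  finiteDimensional := inferInstance
  nonneg b := by
    change 0 ≤ (gnsInner twoTrace b b).re ∧ (gnsInner twoTrace b b).im = 0
    rw [gnsInner_twoTrace_self]
    refine ⟨?_, Complex.ofReal_im _⟩
    rw [Complex.ofReal_re]
    have := fun i j => Complex.normSq_nonneg (b i j)
    exact mul_nonneg zero_le_two (Finset.sum_nonneg fun i _ => Finset.sum_nonneg fun j _ => this i j)
  faithful b hb := by
    change gnsInner twoTrace b b = 0 at hb
    rw [gnsInner_twoTrace_self, Complex.ofReal_eq_zero] at hb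
    have h0 := fun i j => Complex.normSq_nonneg (b i j)
    have h1 : ∑ i, ∑ j, Complex.normSq (b i j) = 0 := by linarith
    ext i j
    rw [Finset.sum_eq_zero_iff_of_nonneg fun i _ => Finset.sum_nonneg fun j _ => h0 i j] at h1
    have h2 := h1 i (Finset.mem_univ _)
    rw [Finset.sum_eq_zero_iff_of_nonneg fun j _ => h0 i j] at h2
    exact Complex.normSq_eq_zero.mp (h2 j (Finset.mem_univ _))
  mul_comul := by
    refine LinearMap.ext fun x => ?_
    rw [LinearMap.comp_apply, comulMap_twoTrace]
    ext i j
    fin_cases i <;> fin_cases j <;>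
      simp [Fin.sum_univ_two, Matrix.add_apply] <;> ring

/-! ### Real symmetric projections and hermitian unitaries -/

theorem Matrix.IsHermitian.exists_eq_conj_diagonal {𝕜 n : Type*} [RCLike 𝕜] [Fintype n]
    [DecidableEq n] {M : Matrix n n 𝕜} (hM : M.IsHermitian) :
    ∃ (U : unitary (Matrix n n 𝕜)) (d : n → ℝ),
      M = U * diagonal (fun i => (d i : 𝕜)) * (star U : Matrix n n 𝕜) :=
  ⟨hM.eigenvectorUnitary, hM.eigenvalues, hM.spectral_theorem⟩

/-- A rank-dichotomy for real symmetric projections in dimension three. -/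
theorem real_projection_fin_three {Q : Matrix (Fin 3) (Fin 3) ℝ} (hQ : Q.IsHermitian)
    (hQQ : Q * Q = Q) :
    ∃ v : Fin 3 → ℝ, v ⬝ᵥ v = 1 ∧
      (Q = 0 ∨ Q = vecMulVec v v ∨ Q = 1 - vecMulVec v v ∨ Q = 1) := by
  obtain ⟨U, d, hU⟩ := hQ.exists_eq_conj_diagonal
  have hU1 : (star U : Matrix (Fin 3) (Fin 3) ℝ) * U = 1 := Unitary.coe_star_mul_self U
  have hU2 : (U : Matrix (Fin 3) (Fin 3) ℝ) * (star U : Matrix (Fin 3) (Fin 3) ℝ) = 1 :=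
    Unitary.coe_mul_star_self U
  set V : Matrix (Fin 3) (Fin 3) ℝ := (U : Matrix (Fin 3) (Fin 3) ℝ) with hV
  have hd : ∀ i, d i * d i = d i := by
    have h1 : star V * Q * V = diagonal d := by
      rw [hU]
      calc _ = (star V * V) * diagonal d * (star V * V) := by simp [mul_assoc]
        _ = _ := by simp [hU1]
    have h2 : diagonal d * diagonal d = diagonal d := by
      rw [← h1]
      calc _ = star V * Q * (V * star V) * Q * V := by simp only [mul_assoc]
        _ = star V * (Q * Q) * V := by rw [hU2]; simp only [mul_assoc, mul_one]
        _ = _ := by rw [hQQ]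
    intro i
    have := congrFun (congrFun h2 i) i
    simpa using this
  have hn : ∀ k, (fun i => V i k) ⬝ᵥ (fun i => V i k) = 1 := by
    intro k
    have := congrFun (congrFun hU1 k) k
    simpa [Matrix.mul_apply, dotProduct] using this
  -- The resolution of the identity lets a sum of two eigenprojections be read as `1 - v vᵀ`.
  have hone : (1 : Matrix (Fin 3) (Fin 3) ℝ) = ∑ k, vecMulVec (fun i => V i k) (fun i => V i k) := by
    rw [← hU2]
    ext i j
    simp [Matrix.mul_apply, Matrix.sum_apply, vecMulVec_apply]
  have hsum : Q = ∑ k, d k • vecMulVec (fun i => V i k) (fun i => V i k) := by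
    rw [hU]
    ext i j
    simp [Matrix.mul_apply, Matrix.sum_apply, vecMulVec_apply, diagonal_apply]
    exact Finset.sum_congr rfl fun k _ => by ring
  have hd' : ∀ i, d i = 0 ∨ d i = 1 := fun i => by
    have h0 : d i * (d i - 1) = 0 := by rw [mul_sub, hd, mul_one, sub_self]
    rcases mul_eq_zero.mp h0 with h | h
    · exact Or.inl h
    · exact Or.inr (by linarith)
  rw [hone]
  rw [Fin.sum_univ_three] at hsum ⊢
  -- In rank one `v` is the eigenvector for `1`, in rank two the one for `0`; in ranks zero and
  -- three any column serves.
  rcases hd' 0 with h0 | h0 <;> rcases hd' 1 with h1 | h1 <;> rcases hd' 2 with h2 | h2 <;>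
    simp only [h0, h1, h2, zero_smul, one_smul, zero_add, add_zero] at hsum
  · exact ⟨_, hn 0, Or.inl hsum⟩
  · exact ⟨_, hn 2, Or.inr (Or.inl hsum)⟩
  · exact ⟨_, hn 1, Or.inr (Or.inl hsum)⟩
  · exact ⟨_, hn 0, Or.inr (Or.inr (Or.inl (by rw [hsum]; abel)))⟩
  · exact ⟨_, hn 0, Or.inr (Or.inl hsum)⟩
  · exact ⟨_, hn 1, Or.inr (Or.inr (Or.inl (by rw [hsum]; abel)))⟩
  · exact ⟨_, hn 2, Or.inr (Or.inr (Or.inl (by rw [hsum]; abel)))⟩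
  · exact ⟨_, hn 0, Or.inr (Or.inr (Or.inr hsum))⟩

/-- The Pauli matrix `σ_z`. -/
def pauliZ : Matrix (Fin 2) (Fin 2) ℂ := !![1, 0; 0, -1]

/-- The eigenvalues are `±1` and sum to zero, so they are `1` and `-1` in some order. Admitting a
sign avoids reordering the eigenvectors, and is harmless because `H` is only used through `H x H`.
-/
theorem exists_unitary_conj_pauliZ {H : Matrix (Fin 2) (Fin 2) ℂ} (hH : H.IsHermitian)
    (hHH : H * H = 1) (htr : H.trace = 0) :
    ∃ U : unitary (Matrix (Fin 2) (Fin 2) ℂ),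
      H = U * pauliZ * (star U : Matrix (Fin 2) (Fin 2) ℂ) ∨
      H = -(U * pauliZ * (star U : Matrix (Fin 2) (Fin 2) ℂ)) := by
  obtain ⟨U, d, hU⟩ := hH.exists_eq_conj_diagonal
  have hU1 : (star U : Matrix (Fin 2) (Fin 2) ℂ) * U = 1 := Unitary.coe_star_mul_self U
  have hU2 : (U : Matrix (Fin 2) (Fin 2) ℂ) * (star U : Matrix (Fin 2) (Fin 2) ℂ) = 1 :=
    Unitary.coe_mul_star_self U
  refine ⟨U, ?_⟩
  set V : Matrix (Fin 2) (Fin 2) ℂ := (U : Matrix (Fin 2) (Fin 2) ℂ) with hV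
  set D : Matrix (Fin 2) (Fin 2) ℂ := diagonal fun i => (d i : ℂ) with hD
  have hU : H = V * D * star V := hU
  have h1 : star V * H * V = D := by
    rw [hU]
    calc _ = (star V * V) * D * (star V * V) := by simp [mul_assoc]
      _ = _ := by simp [hU1]
  have h2 : D * D = 1 := by
    rw [← h1]
    calc _ = star V * H * (V * star V) * H * V := by simp only [mul_assoc]
      _ = star V * (H * H) * V := by rw [hU2]; simp only [mul_assoc, mul_one]
      _ = _ := by rw [hHH, mul_one, hU1]
  have h3 : D.trace = 0 := by
    rw [← h1, Matrix.trace_mul_comm, ← mul_assoc, hU2, one_mul, htr]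
  have h4 : (d 0 : ℂ) * d 0 = 1 := by
    have := congrFun (congrFun h2 0) 0
    simpa [hD] using this
  have h5 : (d 0 : ℂ) + d 1 = 0 := by
    simpa [hD, Matrix.trace_fin_two] using h3
  have h6 : (d 1 : ℂ) = -d 0 := by linear_combination h5
  rcases mul_self_eq_one_iff.mp h4 with h | h
  · left
    rw [hU]
    have : D = pauliZ := by
      ext i j; fin_cases i <;> fin_cases j <;> simp [hD, pauliZ, h, h6]
    rw [this]
  · right
    rw [hU]
    have : D = -pauliZ := by
      ext i j; fin_cases i <;> fin_cases j <;> simp [hD, pauliZ, h, h6]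
    rw [this]
    simp

/-! ### Classification of undirected loopfree quantum graphs on the qubit -/

/-- The columns are the vectorised Pauli matrices. -/
def pauliColumns : Matrix (Fin 2 × Fin 2) (Fin 3) ℂ :=
  of fun p a => (![!![0, 1; 1, 0], !![0, -Complex.I; Complex.I, 0], !![1, 0; 0, -1]] :
    Fin 3 → Matrix (Fin 2) (Fin 2) ℂ) a p.2 p.1

/-- The vectorised identity matrix. -/
def bellVector : Fin 2 × Fin 2 → ℂ := fun p => if p.1 = p.2 then 1 else 0

/-- Together with the vectorised identity, the vectorised Pauli matrices form an orthogonal basis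
whose vectors have square norm `2`. -/
theorem pauliColumns_mul_conjTranspose :
    pauliColumns * pauliColumnsᴴ = 2 - vecMulVec bellVector bellVector := by
  ext ⟨i, k⟩ ⟨j, l⟩
  fin_cases i <;> fin_cases k <;> fin_cases j <;> fin_cases l <;>
    simp [pauliColumns, bellVector, Matrix.mul_apply, Fin.sum_univ_three, vecMulVec_apply,
      Matrix.ofNat_apply, Matrix.sub_apply] <;> norm_num

/-- Swapping the indices transposes, and the transpose of a hermitian matrix is its conjugate. -/
theorem pauliColumns_swap :
    pauliColumns.submatrix Prod.swap id = pauliColumns.map star := by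
  ext ⟨i, k⟩ a
  fin_cases i <;> fin_cases k <;> fin_cases a <;> simp [pauliColumns]

/-- The Choi matrix of a linear map on `M₂`, normalised such that it is a projection for quantum
graphs on `(M₂, 2 Tr)`. -/
def choiMatrix (A : Matrix (Fin 2) (Fin 2) ℂ →ₗ[ℂ] Matrix (Fin 2) (Fin 2) ℂ) :
    Matrix (Fin 2 × Fin 2) (Fin 2 × Fin 2) ℂ :=
  of fun p q => (1 / 2 : ℂ) * A (Matrix.single p.1 q.1 1) p.2 q.2

section Choi

variable {A : Matrix (Fin 2) (Fin 2) ℂ →ₗ[ℂ] Matrix (Fin 2) (Fin 2) ℂ}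

theorem apply_eq_sum_choiMatrix (x : Matrix (Fin 2) (Fin 2) ℂ) (k l : Fin 2) :
    A x k l = ∑ i, ∑ j, x i j * (2 * choiMatrix A (i, k) (j, l)) := by
  conv_lhs => rw [Matrix.matrix_eq_sum_single x]
  simp only [map_sum, Matrix.sum_apply]
  refine Finset.sum_congr rfl fun i _ => Finset.sum_congr rfl fun j _ => ?_
  have h : Matrix.single i j (x i j) = x i j • Matrix.single i j (1 : ℂ) := by
    rw [Matrix.smul_single, smul_eq_mul, mul_one]
  rw [h, map_smul, Matrix.smul_apply, smul_eq_mul, choiMatrix, of_apply]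
  ring

theorem schurMul_single (S T : Matrix (Fin 2) (Fin 2) ℂ →ₗ[ℂ] Matrix (Fin 2) (Fin 2) ℂ)
    (i j : Fin 2) : schurMul twoTrace S T (Matrix.single i j 1) =
      (1 / 2 : ℂ) • ∑ k, S (Matrix.single i k 1) * T (Matrix.single k j 1) := by
  rw [schurMul_twoTrace_apply]
  congr 1
  rw [Finset.sum_eq_single i, Finset.sum_eq_single j]
  · simp
  · intro b _ hb; simp [hb.symm]
  · simp
  · intro b _ hb; simp [hb.symm]
  · simp

/-- The factor one half in `m*` is the one built into `choiMatrix`, so Schur products become exactly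
matrix products. -/
theorem choiMatrix_mul_self (hA : IsQuantumGraph twoTrace A) :
    choiMatrix A * choiMatrix A = choiMatrix A := by
  ext ⟨i, k⟩ ⟨j, l⟩
  have h := schurMul_single A A i j
  rw [hA.schur_idempotent] at h
  simp only [choiMatrix, of_apply, Matrix.mul_apply, Fintype.sum_prod_type]
  rw [h]
  simp only [Matrix.smul_apply, Matrix.add_apply, Matrix.mul_apply, Fin.sum_univ_two, smul_eq_mul]
  ring

theorem choiMatrix_isHermitian (hA : IsQuantumGraph twoTrace A) : (choiMatrix A).IsHermitian := by
  ext ⟨i, k⟩ ⟨j, l⟩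
  have h := hA.map_star (Matrix.single i j 1)
  rw [Matrix.star_eq_conjTranspose, Matrix.star_eq_conjTranspose, Matrix.conjTranspose_single,
    star_one] at h
  simp only [choiMatrix, conjTranspose_apply, of_apply, star_mul']
  have h2 := congrFun (congrFun h l) k
  rw [conjTranspose_apply] at h2
  have h3 : A (Matrix.single i j 1) k l = star (A (Matrix.single j i 1) l k) := by
    rw [h2, star_star]
  rw [h3]
  simp

/-- The coordinate `(i, k)` of the left side is the `(k, k)` entry of `m (A ⊗ Id) m*` at `e_ik`. -/
theorem choiMatrix_mulVec_bellVector (hloop : IsLoopfree twoTrace A) :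
    choiMatrix A *ᵥ bellVector = 0 := by
  ext ⟨i, k⟩
  have h := schurMul_single A LinearMap.id i k
  rw [show schurMul twoTrace A LinearMap.id = 0 from hloop] at h
  have h2 := congrFun (congrFun h k) k
  fin_cases k <;>
  simp [choiMatrix, bellVector, Matrix.mulVec, dotProduct, Fintype.sum_prod_type,
    Fin.sum_univ_two, Matrix.mul_apply, Matrix.single_apply] at h2 ⊢ <;>
  linear_combination (1 / 2) * h2

/-- Self-adjointness exchanges the input and output indices of the Choi matrix at the price of a
conjugation. -/
theorem choiMatrix_swap (hund : IsUndirected twoTrace A) :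
    (choiMatrix A).submatrix Prod.swap Prod.swap = (choiMatrix A).map star := by
  have hadj := isGNSOrthogonal_twoTrace.isGNSAdjoint_gnsAdjoint twoTrace A
  rw [← show A = _ from hund] at hadj
  ext ⟨i, k⟩ ⟨j, l⟩
  have h1 := hadj (Matrix.single i j 1) (Matrix.single k l 1)
  have h3 : star (A (Matrix.single i j 1) k l) = A (Matrix.single k l 1) i j := by
    have e1 : ∀ y : Matrix (Fin 2) (Fin 2) ℂ, gnsInner twoTrace y (Matrix.single k l 1) =
        2 * star (y k l) := by
      intro y
      rw [gnsInner_twoTrace]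
      fin_cases k <;> fin_cases l <;> simp [Fin.sum_univ_two, Matrix.single_apply]
    have e2 : ∀ y : Matrix (Fin 2) (Fin 2) ℂ, gnsInner twoTrace (Matrix.single i j 1) y =
        2 * y i j := by
      intro y
      rw [gnsInner_twoTrace]
      fin_cases i <;> fin_cases j <;> simp [Fin.sum_univ_two, Matrix.single_apply]
    rw [e1, e2] at h1
    exact mul_left_cancel₀ two_ne_zero h1
  simp [choiMatrix, ← h3, map_ofNat (starRingEnd ℂ) 2]

/-- The hermitian matrix `∑ a, v a σ_a`. -/
def pauliVec (v : Fin 3 → ℝ) : Matrix (Fin 2) (Fin 2) ℂ :=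
  of fun k i => ∑ a, pauliColumns (i, k) a * (v a : ℂ)

theorem pauliVec_isHermitian (v : Fin 3 → ℝ) : (pauliVec v).IsHermitian := by
  ext i j
  fin_cases i <;> fin_cases j <;> simp [pauliVec, pauliColumns, Fin.sum_univ_three]

theorem pauliVec_trace (v : Fin 3 → ℝ) : (pauliVec v).trace = 0 := by
  simp [pauliVec, pauliColumns, Fin.sum_univ_three, Matrix.trace_fin_two]

/-- Distinct Pauli matrices anticommute and each squares to `1`, so the square is the scalar `v ⬝ᵥ
v`. -/
theorem pauliVec_mul_self {v : Fin 3 → ℝ} (hv : v ⬝ᵥ v = 1) : pauliVec v * pauliVec v = 1 := by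
  have h : (v 0 : ℂ) * v 0 + v 1 * v 1 + v 2 * v 2 = 1 := by
    rw [dotProduct, Fin.sum_univ_three] at hv
    exact_mod_cast hv
  ext i j
  fin_cases i <;> fin_cases j <;>
    simp [pauliVec, pauliColumns, Fin.sum_univ_three, Matrix.mul_apply, Fin.sum_univ_two] <;>
    ring_nf <;> simp <;> linear_combination h

/-- Up to the factor `√2`, `W` is an isometry onto the complement of the Bell vector, where `P`
lives. Compressing `P` by it loses nothing. -/
theorem exists_real_projection (hA : IsQuantumGraph twoTrace A) (hund : IsUndirected twoTrace A)
    (hloop : IsLoopfree twoTrace A) :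
    ∃ Q : Matrix (Fin 3) (Fin 3) ℝ, Q.IsHermitian ∧ Q * Q = Q ∧
      (2 : ℂ) • choiMatrix A = pauliColumns * Q.map Complex.ofReal * pauliColumnsᴴ := by
  set P := choiMatrix A with hP
  set W := pauliColumns with hW
  have hPP : P * P = P := choiMatrix_mul_self hA
  have hPh : Pᴴ = P := choiMatrix_isHermitian hA
  have hPb : P * (W * Wᴴ) = (2 : ℂ) • P := by
    rw [hW, pauliColumns_mul_conjTranspose, mul_sub, Matrix.mul_vecMulVec,
      choiMatrix_mulVec_bellVector hloop, Matrix.zero_vecMulVec, sub_zero, mul_two, two_smul]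
  have hbP : W * Wᴴ * P = (2 : ℂ) • P := by
    have := congrArg conjTranspose hPb
    simpa [hPh, Matrix.conjTranspose_mul, mul_assoc] using this
  set Q : Matrix (Fin 3) (Fin 3) ℂ := (1 / 2 : ℂ) • (Wᴴ * P * W) with hQ
  have hQreal : Q.map star = Q := by
    have e1 : Q.map star = (1 / 2 : ℂ) • ((W.map star)ᴴ * P.map star * W.map star) := by
      ext a b
      simp [hQ, Matrix.mul_apply, map_ofNat (starRingEnd ℂ) 2]
    -- Conjugating `W` and `P` amounts to swapping their tensor indices, and the swaps cancel inside
    -- the product `Wᴴ * P * W`.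
    rw [e1, ← choiMatrix_swap hund, ← pauliColumns_swap, Matrix.conjTranspose_submatrix]
    have e2 := Matrix.submatrix_mul_equiv Wᴴ P id (Equiv.prodComm (Fin 2) (Fin 2)) Prod.swap
    have e3 := Matrix.submatrix_mul_equiv (Wᴴ * P) W id (Equiv.prodComm (Fin 2) (Fin 2)) id
    rw [Equiv.coe_prodComm] at e2 e3
    rw [e2, e3, Matrix.submatrix_id_id]
  have hQh : Qᴴ = Q := by
    simp [hQ, Matrix.conjTranspose_mul, hPh, Matrix.mul_assoc]
  have hQQ : Q * Q = Q := by
    have e1 : Wᴴ * P * W * (Wᴴ * P * W) = Wᴴ * (P * (W * Wᴴ) * P) * W := by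
      simp only [Matrix.mul_assoc]
    rw [hQ, smul_mul_smul_comm, e1, hPb, smul_mul_assoc, hPP]
    simp only [Matrix.mul_smul, Matrix.smul_mul, smul_smul]
    norm_num
  have hPQ : (2 : ℂ) • P = W * Q * Wᴴ := by
    have e1 : W * (Wᴴ * P * W) * Wᴴ = (W * Wᴴ * P) * (W * Wᴴ) := by
      simp only [Matrix.mul_assoc]
    rw [hQ, Matrix.mul_smul, Matrix.smul_mul, e1, hbP, smul_mul_assoc, hPb, smul_smul, smul_smul]
    norm_num
  have hre : (Q.map Complex.re).map Complex.ofReal = Q := by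
    ext a b
    have := congrFun (congrFun hQreal a) b
    exact Complex.conj_eq_iff_re.mp this
  have hinj : Function.Injective fun M : Matrix (Fin 3) (Fin 3) ℝ => M.map Complex.ofReal :=
    Matrix.map_injective Complex.ofReal_injective
  refine ⟨Q.map Complex.re, hinj ?_, hinj ?_, ?_⟩
  · change (Q.map Complex.re)ᴴ.map Complex.ofReal = (Q.map Complex.re).map Complex.ofReal
    rw [hre]
    rw [← hre] at hQh
    conv_rhs => rw [← hre, ← hQh]
    ext a b
    simp
  · change (Q.map Complex.re * Q.map Complex.re).map Complex.ofRealHom =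
      (Q.map Complex.re).map Complex.ofReal
    rw [Matrix.map_mul]
    change (Q.map Complex.re).map Complex.ofReal * (Q.map Complex.re).map Complex.ofReal = _
    rw [hre, hQQ]
  · rw [hre, hPQ]

/-- Undirected loopfree quantum graphs on `(M₂, 2 Tr)` are, for a suitable hermitian unitary `H`
of trace zero, sums of some of the maps `x ↦ H x H` and `x ↦ 2 Tr(x) 1 - x - H x H`. -/
theorem exists_hermitian_unitary (hA : IsQuantumGraph twoTrace A) (hund : IsUndirected twoTrace A)
    (hloop : IsLoopfree twoTrace A) :
    ∃ (H : Matrix (Fin 2) (Fin 2) ℂ) (p q : Bool), H.IsHermitian ∧ H * H = 1 ∧ H.trace = 0 ∧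
      ∀ x, A x = (if p then H * x * H else 0) +
        (if q then (2 * x.trace) • 1 - x - H * x * H else 0) := by
  obtain ⟨Q, hQ, hQQ, hPQ⟩ := exists_real_projection hA hund hloop
  obtain ⟨v, hv, hcases⟩ := real_projection_fin_three hQ hQQ
  have hH := pauliVec_isHermitian v
  have happly : ∀ x k l, A x k l = ∑ i, ∑ j, x i j *
      (pauliColumns * Q.map Complex.ofReal * pauliColumnsᴴ) (i, k) (j, l) := by
    intro x k l
    rw [apply_eq_sum_choiMatrix, ← hPQ]
    rfl
  -- `W v` is the vectorisation of `H = pauliVec v`, so the projection `v vᵀ` contributes the single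
  -- Kraus operator `H`.
  have hrank : pauliColumns * (vecMulVec v v).map Complex.ofReal * pauliColumnsᴴ =
      of fun p q => pauliVec v p.2 p.1 * pauliVec v q.1 q.2 := by
    have e : (vecMulVec v v).map Complex.ofReal =
        vecMulVec (fun a => (v a : ℂ)) (fun a => (v a : ℂ)) := by
      ext a b; simp [vecMulVec_apply]
    rw [e, Matrix.mul_vecMulVec, Matrix.vecMulVec_mul]
    ext ⟨i, k⟩ ⟨j, l⟩
    rw [vecMulVec_apply, of_apply]
    have h2 : pauliVec v j l = star (pauliVec v l j) := by
      rw [← conjTranspose_apply, hH.eq]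
    rw [h2]
    simp [pauliVec, mulVec, vecMul, dotProduct, mul_comm]
  -- As the kernel of a map, the right side is `x ↦ 2 Tr(x) 1 - x`.
  have hfull : pauliColumns * (1 : Matrix (Fin 3) (Fin 3) ℝ).map Complex.ofReal * pauliColumnsᴴ =
      2 - vecMulVec bellVector bellVector := by
    rw [Matrix.map_one _ Complex.ofReal_zero Complex.ofReal_one, Matrix.mul_one,
      pauliColumns_mul_conjTranspose]
  refine ⟨pauliVec v, ?_⟩
  have hsub : ∀ M N : Matrix (Fin 3) (Fin 3) ℝ, (M - N).map Complex.ofReal =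
      M.map Complex.ofReal - N.map Complex.ofReal := by
    intro M N; ext a b; simp
  rcases hcases with h | h | h | h
  · refine ⟨false, false, hH, pauliVec_mul_self hv, pauliVec_trace v, fun x => ?_⟩
    ext k l
    rw [happly, h]
    simp
  · refine ⟨true, false, hH, pauliVec_mul_self hv, pauliVec_trace v, fun x => ?_⟩
    ext k l
    rw [happly, h, hrank]
    simp [Matrix.mul_apply, Fin.sum_univ_two]
    ring
  · refine ⟨false, true, hH, pauliVec_mul_self hv, pauliVec_trace v, fun x => ?_⟩
    ext k l
    rw [happly, h, hsub, Matrix.mul_sub, Matrix.sub_mul, hrank, hfull]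
    fin_cases k <;> fin_cases l <;>
      simp [Matrix.mul_apply, Fin.sum_univ_two, Matrix.ofNat_apply, bellVector, vecMulVec_apply,
        Matrix.trace_fin_two] <;> ring
  · refine ⟨true, true, hH, pauliVec_mul_self hv, pauliVec_trace v, fun x => ?_⟩
    ext k l
    rw [happly, h, hfull]
    fin_cases k <;> fin_cases l <;>
      simp [Matrix.mul_apply, Fin.sum_univ_two, Matrix.ofNat_apply, bellVector, vecMulVec_apply,
        Matrix.trace_fin_two] <;> ring

end Choi

/-- The quantum graph with Kraus operators `σ_z` (if `p`) and `σ_x`, `σ_y` (if `q`). -/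
def pauliGraph (p q : Bool) : Matrix (Fin 2) (Fin 2) ℂ →ₗ[ℂ] Matrix (Fin 2) (Fin 2) ℂ where
  toFun x := !![(if p then x 0 0 else 0) + (if q then 2 * x 1 1 else 0),
    (if p then -x 0 1 else 0); (if p then -x 1 0 else 0),
    (if p then x 1 1 else 0) + (if q then 2 * x 0 0 else 0)]
  map_add' x y := by
    ext i j
    fin_cases i <;> fin_cases j <;> cases p <;> cases q <;> simp <;> ring
  map_smul' c x := by
    ext i j
    fin_cases i <;> fin_cases j <;> cases p <;> cases q <;> simp <;> ring

theorem pauliGraph_apply (p q : Bool) (x : Matrix (Fin 2) (Fin 2) ℂ) :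
    pauliGraph p q x = !![(if p then x 0 0 else 0) + (if q then 2 * x 1 1 else 0),
      (if p then -x 0 1 else 0); (if p then -x 1 0 else 0),
      (if p then x 1 1 else 0) + (if q then 2 * x 0 0 else 0)] := rfl

/-- On `M₂` the matrix `x` and the three `σ_a x σ_a` add up to `2 Tr(x) 1`. The `q` term is
therefore the contribution of `σ_x` and `σ_y`, whose off-diagonal parts cancel. -/
theorem pauliGraph_eq (p q : Bool) (x : Matrix (Fin 2) (Fin 2) ℂ) :
    pauliGraph p q x = (if p then pauliZ * x * pauliZ else 0) +
      (if q then (2 * x.trace) • 1 - x - pauliZ * x * pauliZ else 0) := by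
  have hZ : pauliZ = diagonal ![1, -1] := by
    ext i j
    fin_cases i <;> fin_cases j <;> simp [pauliZ]
  rw [pauliGraph_apply, hZ]
  ext i j
  fin_cases i <;> fin_cases j <;> cases p <;> cases q <;>
    simp [Matrix.diagonal_mul, Matrix.mul_diagonal, Matrix.trace_fin_two] <;> ring

theorem exists_isomorphic_pauliGraph
    {A : Matrix (Fin 2) (Fin 2) ℂ →ₗ[ℂ] Matrix (Fin 2) (Fin 2) ℂ}
    (hA : IsQuantumGraph twoTrace A) (hund : IsUndirected twoTrace A)
    (hloop : IsLoopfree twoTrace A) :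
    ∃ p q : Bool, QuantumGraphIsomorphic twoTrace A twoTrace (pauliGraph p q) := by
  obtain ⟨H, p, q, hH, hHH, htr, hAx⟩ := exists_hermitian_unitary hA hund hloop
  obtain ⟨U, hU⟩ := exists_unitary_conj_pauliZ hH hHH htr
  have hU1 : (star U : Matrix (Fin 2) (Fin 2) ℂ) * U = 1 := Unitary.coe_star_mul_self U
  have hU2 : (U : Matrix (Fin 2) (Fin 2) ℂ) * (star U : Matrix (Fin 2) (Fin 2) ℂ) = 1 :=
    Unitary.coe_mul_star_self U
  set V : Matrix (Fin 2) (Fin 2) ℂ := (U : Matrix (Fin 2) (Fin 2) ℂ)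
  have hφ : ∀ x, (Unitary.conjStarAlgAut ℂ _ U).symm x = star V * x * V := fun x => rfl
  have htrace : ∀ x : Matrix (Fin 2) (Fin 2) ℂ, (star V * x * V).trace = x.trace := by
    intro x
    rw [Matrix.trace_mul_comm, ← mul_assoc, hU2, one_mul]
  have hHx : ∀ x, H * x * H = V * pauliZ * (star V * x * V) * pauliZ * star V := by
    intro x
    rcases hU with h | h <;> rw [h] <;> simp only [mul_assoc, neg_mul, mul_neg, neg_neg]
  have hconj : ∀ x, star V * (H * x * H) * V = pauliZ * (star V * x * V) * pauliZ := by
    intro x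
    rw [hHx]
    calc _ = (star V * V) * pauliZ * (star V * x * V) * pauliZ * (star V * V) := by
          simp only [mul_assoc]
      _ = _ := by rw [hU1, one_mul, mul_one]
  refine ⟨p, q, (Unitary.conjStarAlgAut ℂ _ U).symm, fun x => ?_, fun x => ?_⟩
  · rw [hφ, twoTrace_apply, twoTrace_apply, ← Matrix.trace_fin_two, ← Matrix.trace_fin_two, htrace]
  · rw [hφ, hφ, pauliGraph_eq, htrace, hAx, mul_add, add_mul]
    congr 1
    · cases p
      · simp
      · simp [hconj]
    · cases q
      · simp
      · simp [mul_sub, sub_mul, hconj, hU1]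

end QubitGraphs

/-! ### Quantum isomorphisms with Cayley graphs on four vertices -/

section FourVertexGraphs

open Matrix

theorem adjacencyMap_apply {V : Type*} [Fintype V] (r : V → V → Prop) [DecidableRel r]
    (f : V → ℂ) (w : V) : adjacencyMap r f w = ∑ v, if r v w then f v else 0 := by
  simp only [adjacencyMap, Matrix.toLin'_apply, Matrix.mulVec, dotProduct, Matrix.of_apply]
  refine Finset.sum_congr rfl fun v _ => ?_
  by_cases h : r v w <;> simp [h]

theorem gnsInner_classicalFunctional {V : Type*} [Fintype V] (f g : V → ℂ) :
    gnsInner (classicalFunctional V) f g = ∑ v, star (f v) * g v := by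
  simp [gnsInner, classicalFunctional]

theorem isGNSOrthogonal_classicalFunctional (V : Type*) [Fintype V] :
    IsGNSOrthogonal (classicalFunctional V) (Pi.basisFun ℂ V) 1 where
  ne_zero := one_ne_zero
  inner i j := by
    classical
    rw [gnsInner_classicalFunctional]
    simp [Pi.single_apply, eq_comm]

/-- The graph on four vertices `0, 1, 2, 3` with edges `01`, `23` (if `p`) and `02`, `03`, `12`,
`13` (if `q`). -/
def fourVertexGraph (p q : Bool) : SimpleGraph (Fin 4) where
  Adj v w := v ≠ w ∧ if v.val / 2 = w.val / 2 then p else q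
  symm := ⟨fun v w h => ⟨h.1.symm, by simp only [eq_comm (a := w.val / 2)]; exact h.2⟩⟩
  loopless := ⟨fun v h => h.1 rfl⟩

theorem adjacencyMap_fourVertexGraph (p q : Bool) (f : Fin 4 → ℂ) :
    adjacencyMap (fourVertexGraph p q).Adj f =
      ![(if p then f 1 else 0) + (if q then f 2 + f 3 else 0),
        (if p then f 0 else 0) + (if q then f 2 + f 3 else 0),
        (if p then f 3 else 0) + (if q then f 0 + f 1 else 0),
        (if p then f 2 else 0) + (if q then f 0 + f 1 else 0)] := by
  classical
  ext w
  rw [adjacencyMap_apply]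
  fin_cases w <;> cases p <;> cases q <;> simp [Fin.sum_univ_four, fourVertexGraph] <;> ring

/-- The star-homomorphism `x ↦ ∑ v, e_v ⊗ τ_v x τ_v*`, where `τ` runs over `1`, `σ_z`, `σ_x` and
`σ_x σ_z`. -/
def weylHom : Matrix (Fin 2) (Fin 2) ℂ →⋆ₐ[ℂ] Matrix (Fin 2) (Fin 2) (Fin 4 → ℂ) where
  toFun x := of ![![![x 0 0, x 0 0, x 1 1, x 1 1], ![x 0 1, -x 0 1, x 1 0, -x 1 0]],
    ![![x 1 0, -x 1 0, x 0 1, -x 0 1], ![x 1 1, x 1 1, x 0 0, x 0 0]]]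
  map_one' := by
    ext i j v
    fin_cases i <;> fin_cases j <;> fin_cases v <;> simp
  map_mul' x y := by
    ext i j v
    fin_cases i <;> fin_cases j <;> fin_cases v <;>
      simp [Matrix.mul_apply, Fin.sum_univ_two] <;> ring
  map_zero' := by
    ext i j v
    fin_cases i <;> fin_cases j <;> fin_cases v <;> simp
  map_add' x y := by
    ext i j v
    fin_cases i <;> fin_cases j <;> fin_cases v <;> simp <;> ring
  commutes' c := by
    ext i j v
    fin_cases i <;> fin_cases j <;> fin_cases v <;> simp [Matrix.algebraMap_matrix_apply]
  map_star' x := by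
    ext i j v
    fin_cases i <;> fin_cases j <;> fin_cases v <;> simp [Matrix.star_apply]

theorem weylHom_apply (x : Matrix (Fin 2) (Fin 2) ℂ) :
    weylHom x = of ![![![x 0 0, x 0 0, x 1 1, x 1 1], ![x 0 1, -x 0 1, x 1 0, -x 1 0]],
      ![![x 1 0, -x 1 0, x 0 1, -x 0 1], ![x 1 1, x 1 1, x 0 0, x 0 0]]] := rfl

/-- The star-homomorphism that sends `e_v` to the projection onto the maximally entangled vector
given by `τ_v`. -/
def bellHom : (Fin 4 → ℂ) →⋆ₐ[ℂ] Matrix (Fin 2) (Fin 2) (Matrix (Fin 2) (Fin 2) ℂ) where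
  toFun f := (1 / 2 : ℂ) •
    of ![![!![f 0 + f 1, 0; 0, f 2 + f 3], !![0, f 0 - f 1; f 2 - f 3, 0]],
      ![!![0, f 2 - f 3; f 0 - f 1, 0], !![f 2 + f 3, 0; 0, f 0 + f 1]]]
  map_one' := by
    ext i j k l
    fin_cases i <;> fin_cases j <;> fin_cases k <;> fin_cases l <;> simp <;> norm_num
  map_mul' f g := by
    ext i j k l
    fin_cases i <;> fin_cases j <;> fin_cases k <;> fin_cases l <;>
      simp [Matrix.mul_apply, Fin.sum_univ_two] <;> ring
  map_zero' := by
    ext i j k l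
    fin_cases i <;> fin_cases j <;> fin_cases k <;> fin_cases l <;> simp
  map_add' f g := by
    ext i j k l
    fin_cases i <;> fin_cases j <;> fin_cases k <;> fin_cases l <;> simp <;> ring
  commutes' c := by
    ext i j k l
    fin_cases i <;> fin_cases j <;> fin_cases k <;> fin_cases l <;>
      simp [Matrix.algebraMap_matrix_apply] <;> ring
  map_star' f := by
    ext i j k l
    fin_cases i <;> fin_cases j <;> fin_cases k <;> fin_cases l <;>
      simp [Matrix.star_apply]

theorem bellHom_apply (f : Fin 4 → ℂ) :
    bellHom f = (1 / 2 : ℂ) •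
    of ![![!![f 0 + f 1, 0; 0, f 2 + f 3], !![0, f 0 - f 1; f 2 - f 3, 0]],
      ![!![0, f 2 - f 3; f 0 - f 1, 0], !![f 2 + f 3, 0; 0, f 0 + f 1]]] := rfl

/-- Modulo phases the `τ_v` form the Klein four-group, so `weylHom` turns `x ↦ σ x σ` into
translation by the class of `σ`. The Kraus operators of the quantum graph become the connection set
of the Cayley graph. -/
theorem pauliGraph_quantumIsomorphic_fourVertexGraph (p q : Bool) :
    QuantumGraphQuantumIsomorphic twoTrace (pauliGraph p q) (classicalFunctional (Fin 4))
      (adjacencyMap (fourVertexGraph p q).Adj) := by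
  refine ⟨2, weylHom, two_pos, IsQuantumIso.of_inner_map isGNSOrthogonal_twoTrace
    (by simp [Module.finrank_matrix]) weylHom ?_, ?_⟩
  · intro x y
    simp only [ampInner, gnsInner_classicalFunctional, gnsInner_twoTrace, ampMap, weylHom_apply]
    simp [Fin.sum_univ_two, Fin.sum_univ_four]
    ring
  · intro x
    ext i j v
    rw [Matrix.map_apply, adjacencyMap_fourVertexGraph, weylHom_apply, weylHom_apply,
      pauliGraph_apply]
    fin_cases i <;> fin_cases j <;> fin_cases v <;> cases p <;> cases q <;> simp <;> ring

/-- Conjugating one tensor leg by a Pauli matrix permutes the four maximally entangled projections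
by the same translation of the Klein four-group. -/
theorem fourVertexGraph_quantumIsomorphic_pauliGraph (p q : Bool) :
    QuantumGraphQuantumIsomorphic (classicalFunctional (Fin 4))
      (adjacencyMap (fourVertexGraph p q).Adj) twoTrace (pauliGraph p q) := by
  refine ⟨2, bellHom, two_pos,
    IsQuantumIso.of_inner_map (isGNSOrthogonal_classicalFunctional (Fin 4))
      (by simp [Module.finrank_matrix]) bellHom ?_, ?_⟩
  · intro x y
    simp only [ampInner, gnsInner_classicalFunctional, gnsInner_twoTrace, ampMap, bellHom_apply]
    simp [Fin.sum_univ_two, Fin.sum_univ_four]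
    ring
  · intro f
    ext i j k l
    rw [Matrix.map_apply, adjacencyMap_fourVertexGraph, bellHom_apply, bellHom_apply,
      pauliGraph_apply]
    fin_cases i <;> fin_cases j <;> fin_cases k <;> fin_cases l <;> cases p <;> cases q <;>
      simp <;> ring

end FourVertexGraphs

/-! ### Classical quantum sets and the voltage graph -/

section Classical

theorem comulMap_classicalFunctional {V : Type*} [Fintype V] [DecidableEq V] (f : V → ℂ) :
    comulMap (classicalFunctional V) f =
      ∑ v, f v • ((Pi.single v 1 : V → ℂ) ⊗ₜ[ℂ] (Pi.single v 1 : V → ℂ)) := by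
  let δ : (V → ℂ) →ₗ[ℂ] (V → ℂ) ⊗[ℂ] (V → ℂ) :=
    { toFun := fun f => ∑ v, f v • ((Pi.single v 1 : V → ℂ) ⊗ₜ[ℂ] (Pi.single v 1 : V → ℂ))
      map_add' := fun f g => by
        simp only [Pi.add_apply, add_smul, Finset.sum_add_distrib]
      map_smul' := fun c f => by
        simp only [Pi.smul_apply, smul_eq_mul, mul_smul, RingHom.id_apply, Finset.smul_sum] }
  have h : comulMap (classicalFunctional V) = δ := by
    refine (isGNSOrthogonal_classicalFunctional V).comulMap_eq fun x y z => ?_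
    change _ = gnsInner _ _ (∑ v, z v •
      ((Pi.single v 1 : V → ℂ) ⊗ₜ[ℂ] (Pi.single v 1 : V → ℂ)))
    simp only [gnsInner_smul_right, gnsInner_sum_right, gnsInner_tmul,
      gnsInner_classicalFunctional]
    refine Finset.sum_congr rfl fun v _ => ?_
    simp [Pi.single_apply]
    ring
  rw [h]
  rfl

theorem schurMul_classicalFunctional_apply {V : Type*} [Fintype V] [DecidableEq V]
    (S T : (V → ℂ) →ₗ[ℂ] (V → ℂ)) (f : V → ℂ) :
    schurMul (classicalFunctional V) S T f =
      ∑ v, f v • (S (Pi.single v 1) * T (Pi.single v 1)) := by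
  simp [schurMul, comulMap_classicalFunctional]

theorem gnsInner_classicalFunctional_self {V : Type*} [Fintype V] (f : V → ℂ) :
    gnsInner (classicalFunctional V) f f = ((∑ v, Complex.normSq (f v) : ℝ) : ℂ) := by
  rw [gnsInner_classicalFunctional]
  push_cast
  simp only [RCLike.star_def, Complex.normSq_eq_conj_mul_self]

theorem isQuantumSet_classicalFunctional (V : Type*) [Fintype V] :
    IsQuantumSet (classicalFunctional V) where
  finiteDimensional := inferInstance
  nonneg f := by
    change 0 ≤ (gnsInner _ f f).re ∧ (gnsInner _ f f).im = 0
    rw [gnsInner_classicalFunctional_self]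
    exact ⟨Finset.sum_nonneg fun v _ => Complex.normSq_nonneg _, Complex.ofReal_im _⟩
  faithful f hf := by
    change gnsInner (classicalFunctional V) f f = 0 at hf
    rw [gnsInner_classicalFunctional_self, Complex.ofReal_eq_zero,
      Finset.sum_eq_zero_iff_of_nonneg fun v _ => Complex.normSq_nonneg _] at hf
    ext v
    exact Complex.normSq_eq_zero.mp (hf v (Finset.mem_univ _))
  mul_comul := by
    classical
    refine LinearMap.ext fun f => ?_
    rw [LinearMap.comp_apply, comulMap_classicalFunctional]
    ext w
    simp [Pi.single_apply]

/-- On `ℂ^V` the Schur product multiplies matrices entrywise, and the entries `0` and `1` are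
idempotent and real. -/
theorem isQuantumGraph_adjacencyMap {V : Type*} [Fintype V] (r : V → V → Prop) :
    IsQuantumGraph (classicalFunctional V) (adjacencyMap r) where
  schur_idempotent := by
    classical
    refine LinearMap.ext fun f => ?_
    rw [schurMul_classicalFunctional_apply]
    ext w
    simp only [Finset.sum_apply, Pi.smul_apply, Pi.mul_apply, adjacencyMap_apply]
    refine Finset.sum_congr rfl fun v _ => ?_
    simp only [Pi.single_apply]
    rw [Finset.sum_eq_single v]
    · by_cases h : r v w <;> simp [h]
    · intro b _ hb; simp [hb]
    · simp
  map_star f := by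
    classical
    ext w
    simp only [Pi.star_apply, adjacencyMap_apply, star_sum]
    refine Finset.sum_congr rfl fun v _ => ?_
    by_cases h : r v w <;> simp [h]

/-- The `ℤ/2`-voltage graph on two vertices with a loop labelled `1` at each vertex (if `p`) and
edges in both directions with both labels between the vertices (if `q`). -/
def twoVertexVoltageGraph (p q : Bool) : VoltageGraph (Fin 2) (ZMod 2) where
  E := {e : Fin 2 × Fin 2 × ZMod 2 // if e.1 = e.2.1 then e.2.2 = 1 ∧ p else q}
  finite_edges := inferInstance
  s e := e.1.1
  t e := e.1.2.1
  label e := e.1.2.2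

theorem preSimple_twoVertexVoltageGraph (p q : Bool) : (twoVertexVoltageGraph p q).PreSimple := by
  rintro ⟨⟨a, b, c⟩, h⟩ ⟨⟨a', b', c'⟩, h'⟩ h1 h2 h3
  have h1 : a = a' := h1
  have h2 : b = b' := h2
  have h3 : c = c' := h3
  subst h1 h2 h3
  rfl

theorem twoVertexVoltageGraph_adjacency (p q : Bool) (g : ZMod 2) (f : Fin 2 → ℂ) :
    (twoVertexVoltageGraph p q).adjacency g f =
      ![(if g = 1 ∧ p then f 0 else 0) + (if q then f 1 else 0),
        (if g = 1 ∧ p then f 1 else 0) + (if q then f 0 else 0)] := by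
  have h : (twoVertexVoltageGraph p q).adjacency g =
      adjacencyMap fun v w => if v = w then g = 1 ∧ p else q := by
    rw [VoltageGraph.adjacency]
    congr 1
    ext v w
    constructor
    · rintro ⟨⟨⟨a, b, c⟩, he⟩, h1, h2, h3⟩
      have h1 : a = v := h1
      have h2 : b = w := h2
      have h3 : c = g := h3
      subst h1 h2 h3
      exact he
    · intro hvw
      exact ⟨⟨⟨v, w, g⟩, hvw⟩, rfl, rfl, rfl⟩
  classical
  ext w
  rw [h, adjacencyMap_apply]
  fin_cases w <;> simp [Fin.sum_univ_two, add_comm]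

end Classical

/-! ### The dual of `ℤ/2` and the swap action -/

section Dual

/-- The nontrivial character of `ℤ/2`. -/
def signChar : DualGroup (ZMod 2) :=
  AddChar.zmodChar 2 (ζ := (-1 : ℂ)) (by norm_num)

@[simp] theorem signChar_one : signChar 1 = -1 := by
  simp [signChar, AddChar.zmodChar_apply, ZMod.val_one]

theorem signChar_ne_one : signChar ≠ 1 := by
  intro h
  have := DFunLike.congr_fun h 1
  rw [signChar_one, AddChar.one_apply] at this
  norm_num at this

theorem dualGroup_eq_one_or (χ : DualGroup (ZMod 2)) : χ = 1 ∨ χ = signChar := by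
  have h2 : χ 1 * χ 1 = 1 := by
    rw [← AddChar.map_add_eq_mul, show (1 + 1 : ZMod 2) = 0 by decide, AddChar.map_zero_eq_one]
  rcases mul_self_eq_one_iff.mp h2 with h | h
  · left
    refine DFunLike.ext _ _ fun a => ?_
    fin_cases a
    · exact χ.map_zero_eq_one
    · exact h
  · right
    refine DFunLike.ext _ _ fun a => ?_
    fin_cases a
    · exact χ.map_zero_eq_one.trans signChar.map_zero_eq_one.symm
    · exact h.trans signChar_one.symm

@[simp] theorem signChar_mul_self : signChar * signChar = 1 := by
  rcases dualGroup_eq_one_or (signChar * signChar) with h | h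
  · exact h
  · exact absurd (mul_eq_left.mp h) signChar_ne_one

@[simp] theorem signChar_inv : signChar⁻¹ = signChar :=
  inv_eq_of_mul_eq_one_left signChar_mul_self

theorem univ_dualGroup : (Finset.univ : Finset (DualGroup (ZMod 2))) = {1, signChar} := by
  ext χ
  simp [dualGroup_eq_one_or χ]

theorem sum_dualGroup {M : Type*} [AddCommMonoid M] (f : DualGroup (ZMod 2) → M) :
    ∑ χ, f χ = f 1 + f signChar := by
  rw [univ_dualGroup, Finset.sum_pair signChar_ne_one.symm]

theorem card_dualGroup : Fintype.card (DualGroup (ZMod 2)) = 2 := by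
  rw [← Finset.card_univ, univ_dualGroup, Finset.card_pair signChar_ne_one.symm]

theorem swapAction_one (f : Fin 2 → ℂ) : swapAction 1 f = f := by
  rw [map_one]; rfl

theorem swapAction_signChar (f : Fin 2 → ℂ) : swapAction signChar f = ![f 1, f 0] := by
  have h : swapHom signChar = Equiv.swap 0 1 := by
    simp [swapHom, signChar_ne_one]
  ext v
  change f ((swapHom signChar)⁻¹ v) = _
  rw [h]
  fin_cases v <;> simp

end Dual

/-! ### The crossed product `ℂ² ⋊ ℤ/2` as `M₂` -/

section CrossedProductQubit

open Matrix

theorem swapCrossedProduct_mul_one (x y : CrossedProduct swapAction) :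
    (x * y) 1 = x 1 * y 1 + x signChar * ![y signChar 1, y signChar 0] := by
  rw [CrossedProduct.mul_apply, sum_dualGroup]
  simp [swapAction_signChar]

theorem swapCrossedProduct_mul_signChar (x y : CrossedProduct swapAction) :
    (x * y) signChar = x 1 * y signChar + x signChar * ![y 1 1, y 1 0] := by
  rw [CrossedProduct.mul_apply, sum_dualGroup]
  simp [swapAction_signChar]

theorem swapCrossedProduct_ext {x y : CrossedProduct swapAction} (h1 : x 1 = y 1)
    (h2 : x signChar = y signChar) : x = y := by
  ext χ : 1
  rcases dualGroup_eq_one_or χ with rfl | rfl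
  · exact h1
  · exact h2

open Classical in
/-- The identification of `M₂` with `ℂ² ⋊ ℤ/2`: diagonal matrices correspond to `ℂ²` and `σ_x`
to the canonical unitary of the nontrivial character. -/
def qubitToCrossedProduct (x : Matrix (Fin 2) (Fin 2) ℂ) : CrossedProduct swapAction :=
  fun χ => if χ = 1 then ![x 0 0, x 1 1] else ![x 0 1, x 1 0]

theorem qubitToCrossedProduct_one (x : Matrix (Fin 2) (Fin 2) ℂ) :
    qubitToCrossedProduct x 1 = ![x 0 0, x 1 1] := if_pos rfl

theorem qubitToCrossedProduct_signChar (x : Matrix (Fin 2) (Fin 2) ℂ) :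
    qubitToCrossedProduct x signChar = ![x 0 1, x 1 0] := if_neg signChar_ne_one

/-- The star-isomorphism of `M₂` with `ℂ² ⋊ ℤ/2`. -/
def qubitEquivCrossedProduct :
    Matrix (Fin 2) (Fin 2) ℂ ≃⋆ₐ[ℂ] CrossedProduct swapAction where
  toFun := qubitToCrossedProduct
  invFun y := !![y 1 0, y signChar 0; y signChar 1, y 1 1]
  left_inv x := by
    ext i j
    fin_cases i <;> fin_cases j <;>
      simp [qubitToCrossedProduct_one, qubitToCrossedProduct_signChar]
  right_inv y := by
    refine swapCrossedProduct_ext ?_ ?_ <;> ext v <;> fin_cases v <;>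
      simp [qubitToCrossedProduct_one, qubitToCrossedProduct_signChar]
  map_mul' x y := by
    refine swapCrossedProduct_ext ?_ ?_ <;> ext v <;> fin_cases v <;>
      simp [qubitToCrossedProduct_one, qubitToCrossedProduct_signChar,
        swapCrossedProduct_mul_one, swapCrossedProduct_mul_signChar, Matrix.mul_apply] <;> ring
  map_add' x y := by
    refine swapCrossedProduct_ext ?_ ?_ <;> ext v <;> fin_cases v <;>
      simp [qubitToCrossedProduct_one, qubitToCrossedProduct_signChar]
  map_star' x := by
    refine swapCrossedProduct_ext ?_ ?_ <;> ext v <;> fin_cases v <;>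
      simp [qubitToCrossedProduct_one, qubitToCrossedProduct_signChar,
        CrossedProduct.star_apply, swapAction_signChar, Matrix.star_apply]
  map_smul' c x := by
    refine swapCrossedProduct_ext ?_ ?_ <;> ext v <;> fin_cases v <;>
      simp [qubitToCrossedProduct_one, qubitToCrossedProduct_signChar]

theorem qubitEquivCrossedProduct_one (x : Matrix (Fin 2) (Fin 2) ℂ) :
    qubitEquivCrossedProduct x 1 = ![x 0 0, x 1 1] := if_pos rfl

theorem qubitEquivCrossedProduct_signChar (x : Matrix (Fin 2) (Fin 2) ℂ) :
    qubitEquivCrossedProduct x signChar = ![x 0 1, x 1 0] := if_neg signChar_ne_one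

theorem functional_qubitEquivCrossedProduct (x : Matrix (Fin 2) (Fin 2) ℂ) :
    CrossedProduct.functional swapAction (classicalFunctional (Fin 2))
      (qubitEquivCrossedProduct x) = twoTrace x := by
  change (Fintype.card (DualGroup (ZMod 2)) : ℂ) *
    classicalFunctional (Fin 2) (qubitEquivCrossedProduct x 1) = _
  rw [card_dualGroup, qubitEquivCrossedProduct_one, twoTrace_apply]
  simp [classicalFunctional]

/-- The inclusion of `ℂ²` into its crossed product. -/
def swapInclusion : (Fin 2 → ℂ) →ₗ[ℂ] CrossedProduct swapAction where
  toFun f := qubitEquivCrossedProduct !![f 0, 0; 0, f 1]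
  map_add' f g := by
    rw [← map_add]; congr 1
    ext i j; fin_cases i <;> fin_cases j <;> simp
  map_smul' c f := by
    rw [RingHom.id_apply, ← map_smul]; congr 1
    ext i j; fin_cases i <;> fin_cases j <;> simp

theorem swapInclusion_apply (f : Fin 2 → ℂ) :
    swapInclusion f = qubitEquivCrossedProduct !![f 0, 0; 0, f 1] := rfl

theorem condExp_qubitEquivCrossedProduct (x : Matrix (Fin 2) (Fin 2) ℂ) :
    CrossedProduct.condExp swapAction (qubitEquivCrossedProduct x) =
      (2 : ℂ) • ![x 0 0, x 1 1] := by
  change (Fintype.card (DualGroup (ZMod 2)) : ℂ) • qubitEquivCrossedProduct x 1 = _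
  rw [card_dualGroup, qubitEquivCrossedProduct_one]
  norm_num

/-- The factor `n` in `E` equals the one in `ψ_⋊`, so the adjoint of `E` is the inclusion without
any scaling. -/
theorem gnsAdjoint_condExp :
    gnsAdjoint (CrossedProduct.functional swapAction (classicalFunctional (Fin 2)))
      (classicalFunctional (Fin 2)) (CrossedProduct.condExp swapAction) = swapInclusion := by
  refine (isGNSOrthogonal_twoTrace.map functional_qubitEquivCrossedProduct).gnsAdjoint_eq
    fun x y => ?_
  obtain ⟨x, rfl⟩ := EquivLike.surjective qubitEquivCrossedProduct x
  rw [swapInclusion_apply, gnsInner_map functional_qubitEquivCrossedProduct,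
    condExp_qubitEquivCrossedProduct, gnsInner_classicalFunctional, gnsInner_twoTrace]
  simp [Fin.sum_univ_two]
  ring

theorem qubitEquivCrossedProduct_sigmaX :
    qubitEquivCrossedProduct !![0, 1; 1, 0] = CrossedProduct.u signChar := by
  refine swapCrossedProduct_ext ?_ ?_
  · rw [qubitEquivCrossedProduct_one, CrossedProduct.u, CrossedProduct.single,
      Pi.single_eq_of_ne signChar_ne_one.symm]
    ext v; fin_cases v <;> simp
  · rw [qubitEquivCrossedProduct_signChar, CrossedProduct.u, CrossedProduct.single,
      Pi.single_eq_same]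
    ext v; fin_cases v <;> simp

/-- The canonical unitaries become `1` and `σ_x`, and the factor `2` of `2 Tr` cancels the prefactor
`1/n`. -/
theorem xMap_qubitEquivCrossedProduct (g : ZMod 2) (x : Matrix (Fin 2) (Fin 2) ℂ) :
    xMap (classicalFunctional (Fin 2)) swapAction g (qubitEquivCrossedProduct x) =
      qubitEquivCrossedProduct ((x 0 0 + x 1 1) • 1 +
        (star (signChar g) * (x 0 1 + x 1 0)) • !![0, 1; 1, 0]) := by
  have h1 : (CrossedProduct.u 1 : CrossedProduct swapAction) = qubitEquivCrossedProduct 1 := by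
    rw [map_one]; rfl
  change (Fintype.card (ZMod 2) : ℂ)⁻¹ • ∑ χ : DualGroup (ZMod 2),
    (star (χ g) * gnsInner (CrossedProduct.functional swapAction (classicalFunctional (Fin 2)))
      (CrossedProduct.u χ) (qubitEquivCrossedProduct x)) •
      (CrossedProduct.u χ : CrossedProduct swapAction) = _
  rw [sum_dualGroup, h1, ← qubitEquivCrossedProduct_sigmaX,
    gnsInner_map functional_qubitEquivCrossedProduct,
    gnsInner_map functional_qubitEquivCrossedProduct, ZMod.card, gnsInner_twoTrace,
    gnsInner_twoTrace, ← map_smul, ← map_smul, ← map_add, ← map_smul]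
  congr 1
  ext i j
  fin_cases i <;> fin_cases j <;> simp [Fin.sum_univ_two] <;> ring

/-- The map that corresponds to `X_g` on `M₂`. -/
def qubitXMap (g : ZMod 2) : Matrix (Fin 2) (Fin 2) ℂ →ₗ[ℂ] Matrix (Fin 2) (Fin 2) ℂ :=
  qubitEquivCrossedProduct.toLin.symm.toLinearMap ∘ₗ
    xMap (classicalFunctional (Fin 2)) swapAction g ∘ₗ
      qubitEquivCrossedProduct.toLin.toLinearMap

theorem qubitXMap_apply (g : ZMod 2) (x : Matrix (Fin 2) (Fin 2) ℂ) :
    qubitXMap g x = (x 0 0 + x 1 1) • 1 +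
        (star (signChar g) * (x 0 1 + x 1 0)) • !![0, 1; 1, 0] := by
  simp [qubitXMap, xMap_qubitEquivCrossedProduct]

/-- The map that corresponds to `E* A E` on `M₂`. -/
def qubitInflation (A : (Fin 2 → ℂ) →ₗ[ℂ] (Fin 2 → ℂ)) :
    Matrix (Fin 2) (Fin 2) ℂ →ₗ[ℂ] Matrix (Fin 2) (Fin 2) ℂ :=
  qubitEquivCrossedProduct.toLin.symm.toLinearMap ∘ₗ
    (swapInclusion ∘ₗ A ∘ₗ CrossedProduct.condExp swapAction) ∘ₗ
      qubitEquivCrossedProduct.toLin.toLinearMap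

theorem qubitInflation_apply (A : (Fin 2 → ℂ) →ₗ[ℂ] (Fin 2 → ℂ))
    (x : Matrix (Fin 2) (Fin 2) ℂ) :
    qubitInflation A x =
      (2 : ℂ) • !![A ![x 0 0, x 1 1] 0, 0; 0, A ![x 0 0, x 1 1] 1] := by
  simp only [qubitInflation, LinearMap.comp_apply, LinearEquiv.coe_coe, StarAlgEquiv.toLin_apply,
    StarAlgEquiv.toLin_symm_apply, condExp_qubitEquivCrossedProduct, map_smul, swapInclusion_apply,
    StarAlgEquiv.symm_apply_apply]

/-- In `X_1` the matrix `σ_x` carries the sign `-1`, so the loops labelled `1` yield `x ↦ σ_z x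
σ_z`. Between the vertices both labels occur; there the `σ_x` parts of `X_0` and `X_1` cancel, and
only the exchange of the diagonal entries, doubled, survives. -/
theorem derivedQuantumGraph_qubitEquivCrossedProduct (p q : Bool)
    (x : Matrix (Fin 2) (Fin 2) ℂ) :
    derivedQuantumGraph (classicalFunctional (Fin 2)) swapAction
      (twoVertexVoltageGraph p q).adjacency (qubitEquivCrossedProduct x) =
      qubitEquivCrossedProduct (pauliGraph p q x) := by
  have h : ∀ g, schurMul (CrossedProduct.functional swapAction (classicalFunctional (Fin 2)))
      (xMap (classicalFunctional (Fin 2)) swapAction g)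
      (swapInclusion ∘ₗ (twoVertexVoltageGraph p q).adjacency g ∘ₗ
        CrossedProduct.condExp swapAction) (qubitEquivCrossedProduct x) =
      qubitEquivCrossedProduct (schurMul twoTrace (qubitXMap g)
        (qubitInflation ((twoVertexVoltageGraph p q).adjacency g)) x) := by
    intro g
    exact schurMul_map isGNSOrthogonal_twoTrace functional_qubitEquivCrossedProduct
      (fun b => by simp [qubitXMap]) (fun b => by simp [qubitInflation]) x
  have huniv : (Finset.univ : Finset (ZMod 2)) = {0, 1} := rfl
  rw [derivedQuantumGraph, gnsAdjoint_condExp, LinearMap.sum_apply]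
  simp only [h]
  rw [huniv, Finset.sum_pair zero_ne_one, ← map_add, schurMul_twoTrace_apply,
    schurMul_twoTrace_apply, pauliGraph_apply]
  congr 1
  simp only [qubitXMap_apply, qubitInflation_apply, twoVertexVoltageGraph_adjacency]
  ext i j
  fin_cases i <;> fin_cases j <;> cases p <;> cases q <;>
    simp [Fin.sum_univ_two, Matrix.single_apply, Matrix.mul_apply] <;> ring

theorem isVoltageQuantumGraph_twoVertexVoltageGraph (p q : Bool) :
    IsVoltageQuantumGraph (classicalFunctional (Fin 2)) swapAction
      (twoVertexVoltageGraph p q).adjacency where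
  isQuantumSet := isQuantumSet_classicalFunctional (Fin 2)
  functional_act χ f := by
    rcases dualGroup_eq_one_or χ with rfl | rfl
    · rw [swapAction_one]
    · rw [swapAction_signChar]
      simp [classicalFunctional, Fin.sum_univ_two, add_comm]
  isQuantumGraph g := isQuantumGraph_adjacencyMap _
  commute_act g χ f := by
    rcases dualGroup_eq_one_or χ with rfl | rfl
    · rw [swapAction_one, swapAction_one]
    · rw [swapAction_signChar, swapAction_signChar, twoVertexVoltageGraph_adjacency,
        twoVertexVoltageGraph_adjacency]
      simp

end CrossedProductQubit
end

theorem mainTheorem5 (A : Matrix (Fin 2) (Fin 2) ℂ →ₗ[ℂ] Matrix (Fin 2) (Fin 2) ℂ)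
    (hA : IsQuantumGraph twoTrace A) (hund : IsUndirected twoTrace A)
    (hloop : IsLoopfree twoTrace A) :
    (∃ Γ : VoltageGraph (Fin 2) (ZMod 2), Γ.PreSimple ∧
      IsVoltageQuantumGraph (classicalFunctional (Fin 2)) swapAction Γ.adjacency ∧
      IsQuantumSet (CrossedProduct.functional swapAction (classicalFunctional (Fin 2))) ∧
      IsQuantumGraph (CrossedProduct.functional swapAction (classicalFunctional (Fin 2)))
        (derivedQuantumGraph (classicalFunctional (Fin 2)) swapAction Γ.adjacency) ∧
      QuantumGraphIsomorphic twoTrace A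
        (CrossedProduct.functional swapAction (classicalFunctional (Fin 2)))
        (derivedQuantumGraph (classicalFunctional (Fin 2)) swapAction Γ.adjacency)) ∧
    (∃ Δ : SimpleGraph (Fin 4),
      QuantumGraphQuantumIsomorphic twoTrace A
        (classicalFunctional (Fin 4)) (adjacencyMap Δ.Adj) ∧
      QuantumGraphQuantumIsomorphic (classicalFunctional (Fin 4)) (adjacencyMap Δ.Adj)
        twoTrace A) := by
  obtain ⟨p, q, hiso⟩ := exists_isomorphic_pauliGraph hA hund hloop
  have hder : QuantumGraphIsomorphic twoTrace A
      (CrossedProduct.functional swapAction (classicalFunctional (Fin 2)))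
      (derivedQuantumGraph (classicalFunctional (Fin 2)) swapAction
        (twoVertexVoltageGraph p q).adjacency) :=
    hiso.trans ⟨qubitEquivCrossedProduct, functional_qubitEquivCrossedProduct,
      fun x => (derivedQuantumGraph_qubitEquivCrossedProduct p q x).symm⟩
  refine ⟨⟨twoVertexVoltageGraph p q, preSimple_twoVertexVoltageGraph p q,
    isVoltageQuantumGraph_twoVertexVoltageGraph p q,
    isQuantumSet_twoTrace.map isGNSOrthogonal_twoTrace functional_qubitEquivCrossedProduct,
    ?_, hder⟩, fourVertexGraph p q,
    hiso.trans_quantum (pauliGraph_quantumIsomorphic_fourVertexGraph p q),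
    (fourVertexGraph_quantumIsomorphic_pauliGraph p q).trans_symm hiso⟩
  -- The derived graph inherits the quantum graph axioms from `A` through the isomorphism, so
  -- nothing has to be checked in the crossed product.
  obtain ⟨φ, hφ, hφA⟩ := hder
  exact hA.map isGNSOrthogonal_twoTrace hφ hφA
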